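/- **Model.** Let $a_1=1$, $a_2=e^{i\pi/3}\in\mathbb C\cong\mathbb R^2$ and let the Kagome lattice have sites $R$, $R+a_1/2$, $R+a_2/2$ for $R\in\mathbb Z a_1+\mathbb Z a_2$. Orient all nearest-neighbour bonds so that the arrows circulate in the same sense around every triangle (all counterclockwise, or all clockwise). For a finite-index subgroup $\Gamma\subset\mathbb Z a_1+\mathbb Z a_2$, consider the lattice on the torus $\mathbb C/\Gamma$ (periodic boundary conditions), and let $N=[\mathbb Z a_1+\mathbb Z a_2:\Gamma]$ be the number of unit cells. The torus has modulus $\tau$ ($\operatorname{Im}\tau>0$) if $\Gamma=\mathbb Z w_1+\mathbb Z w_2$ with $w_2/w_1=\tau$. The hopping Hamiltonian is $$H_0=\tfrac12\sum_{i\leftarrow j}\bigl(\mathrm i\,c_i^\dagger c_j+\mathrm{h.c.}\bigr),$$ the sum running over all arrows $j\to i$ of the torus. Its lowest band is the span of the Bloch eigenstates of lowest energy at each crystal momentum; the middle band lies exactly at energy $0$. Flattening the lowest band to the energy $\varepsilon<0$ means replacing $H_0$ by the hopping operator $T^{\varepsilon}$ which equals $\varepsilon$ on the lowest band and is unchanged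 on the two other bands (so the lowest band stays lowest). For spin-$\frac12$ electrons let $$H=\sum_{x,y,\sigma}T^{\varepsilon}_{xy}\,c^\dagger_{x,\sigma}c_{y,\sigma}+U\sum_x n_{x,+}n_{x,-}.$$ **Theorem.** For either orientation and every modulus $\tau$ with $\operatorname{Im}\tau>0$ there is $N_0$ such that, for every torus of modulus $\tau$ with $N\ge N_0$ unit cells, every $\varepsilon<0$ and every $U>0$, the ground state of $H$ with $N$ electrons is fully spin-polarized and unique up to the spin degeneracy: all ground states in the $N$-electron sector have total spin $S=N/2$, and the ground-state space has dimension exactly $2S+1=N+1$. -/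

import Mathlib

open Complex

noncomputable section

/-! ### Fermionic Fock space of spin-1/2 electrons on a finite set of sites -/

section Fock

/-- A one-particle mode: a site together with a spin (`true` is spin up, `false` is spin down). -/
abbrev Mode (Λ : Type*) := Λ × Bool

/-- The fermionic Fock space over the sites `Λ`, in the occupation number basis: the orthonormal
basis vectors are indexed by the sets of occupied modes. -/
abbrev Fock (Λ : Type*) := EuclideanSpace ℂ (Finset (Mode Λ))

variable {Λ : Type*} [Fintype Λ]

/-- The position of a mode in a fixed enumeration of the modes. -/
def modeRank (m : Mode Λ) : ℕ := (Fintype.equivFin (Mode Λ) m : ℕ)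

/-- The fermionic sign `(-1) ^ #{n ∈ S | n comes before m}`. -/
def modeSign (m : Mode Λ) (S : Finset (Mode Λ)) : ℂ :=
  (-1) ^ (S.filter fun n => modeRank n < modeRank m).card

open scoped Classical in
/-- The annihilation operator `c_m`: it sends the basis vector of an occupation set `S ∌ m` to `0`
and that of `insert m S` (with `m ∉ S`) to `modeSign m S` times that of `S`. -/
def annihilate (m : Mode Λ) : Fock Λ →ₗ[ℂ] Fock Λ where
  toFun ψ := WithLp.toLp 2 fun S => if m ∈ S then 0 else modeSign m S * ψ (insert m S)
  map_add' ψ φ := by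
    ext S
    by_cases h : m ∈ S <;> simp [h, mul_add]
  map_smul' a ψ := by
    ext S
    by_cases h : m ∈ S <;> simp [h, mul_left_comm]

/-- The creation operator `c_m†`, the adjoint of `c_m`. -/
def create (m : Mode Λ) : Fock Λ →ₗ[ℂ] Fock Λ := LinearMap.adjoint (annihilate m)

/-- The occupation number operator `n_m = c_m† c_m`. -/
def occupation (m : Mode Λ) : Fock Λ →ₗ[ℂ] Fock Λ := create m ∘ₗ annihilate m

variable (Λ) in
/-- The total number operator. -/
def numberOp : Fock Λ →ₗ[ℂ] Fock Λ := ∑ m : Mode Λ, occupation m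

variable (Λ) in
/-- The subspace of states with exactly `n` electrons. -/
def sector (n : ℕ) : Submodule ℂ (Fock Λ) := Module.End.eigenspace (numberOp Λ) (n : ℂ)

variable (Λ) in
/-- `S⁺ = ∑ₓ c†_{x↑} c_{x↓}`. -/
def spinRaise : Fock Λ →ₗ[ℂ] Fock Λ := ∑ x : Λ, create (x, true) ∘ₗ annihilate (x, false)

variable (Λ) in
/-- `S⁻ = ∑ₓ c†_{x↓} c_{x↑}`. -/
def spinLower : Fock Λ →ₗ[ℂ] Fock Λ := ∑ x : Λ, create (x, false) ∘ₗ annihilate (x, true)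

variable (Λ) in
/-- `Sᶻ = ½ ∑ₓ (n_{x↑} - n_{x↓})`. -/
def spinZ : Fock Λ →ₗ[ℂ] Fock Λ :=
  (1 / 2 : ℂ) • ∑ x : Λ, (occupation (x, true) - occupation (x, false))

variable (Λ) in
/-- The total spin operator `S² = (Sᶻ)² + ½ (S⁺ S⁻ + S⁻ S⁺)`. -/
def spinSq : Fock Λ →ₗ[ℂ] Fock Λ :=
  spinZ Λ ∘ₗ spinZ Λ +
    (1 / 2 : ℂ) • (spinRaise Λ ∘ₗ spinLower Λ + spinLower Λ ∘ₗ spinRaise Λ)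

/-- The Hubbard Hamiltonian
`∑_{x,y,σ} t_{xy} c†_{xσ} c_{yσ} + U ∑ₓ n_{x↑} n_{x↓}`. -/
def hubbard (t : Matrix Λ Λ ℂ) (U : ℝ) : Fock Λ →ₗ[ℂ] Fock Λ :=
  (∑ x : Λ, ∑ y : Λ, ∑ σ : Bool, t x y • (create (x, σ) ∘ₗ annihilate (y, σ))) +
    (U : ℂ) • ∑ x : Λ, occupation (x, true) ∘ₗ occupation (x, false)

/-- The energy levels (eigenvalues) of `H` in the sector with `n` electrons. -/
def energyLevels (H : Fock Λ →ₗ[ℂ] Fock Λ) (n : ℕ) : Set ℝ :=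
  {E | ∃ φ ∈ sector Λ n, φ ≠ 0 ∧ H φ = (E : ℂ) • φ}

/-- The space of states with `n` electrons and energy `E`. -/
def levelSpace (H : Fock Λ →ₗ[ℂ] Fock Λ) (n : ℕ) (E : ℝ) : Submodule ℂ (Fock Λ) :=
  sector Λ n ⊓ Module.End.eigenspace H (E : ℂ)

/-- The ground state of `H` with `n` electrons is fully spin-polarized and unique up to the spin
degeneracy: there is a lowest energy level in the sector with `n` electrons, all its states have
total spin quantum number `S = n / 2`, and its degeneracy is exactly `2 S + 1 = n + 1`. -/
def IsUniqueFerromagnet (H : Fock Λ →ₗ[ℂ] Fock Λ) (n : ℕ) : Prop :=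
  ∃ E₀ : ℝ, IsLeast (energyLevels H n) E₀ ∧
    (∀ ψ ∈ levelSpace H n E₀, spinSq Λ ψ = ((n : ℂ) / 2 * ((n : ℂ) / 2 + 1)) • ψ) ∧
    Module.finrank ℂ (levelSpace H n E₀) = n + 1

end Fock

/-! ### The Kagome lattice model on a torus -/

/-- The position in the plane `ℂ` of the Bravais lattice vector `p.1 a₁ + p.2 a₂`, with
`a₁ = 1` and `a₂ = exp (iπ/3)`. -/
def bravais (p : ℤ × ℤ) : ℂ := (p.1 : ℂ) + (p.2 : ℂ) * exp (I * (Real.pi / 3))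

/-- The torus with period lattice `Γ` has modulus `τ`: `Γ` has a basis `w₁, w₂` with
`w₂ / w₁ = τ` as vectors of the plane `ℂ`. -/
def HasModulus (Γ : AddSubgroup (ℤ × ℤ)) (τ : ℂ) : Prop :=
  ∃ w₁ w₂ : ℤ × ℤ, Γ = AddSubgroup.closure {w₁, w₂} ∧ bravais w₁ ≠ 0 ∧
    bravais w₂ = τ * bravais w₁

/-- The unit cells of the torus with period lattice `Γ`. -/
abbrev Cell (Γ : AddSubgroup (ℤ × ℤ)) := (ℤ × ℤ) ⧸ Γ

/-- The Kagome sites of the torus. The sublattices `0, 1, 2` of the cell at `R` are at the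
positions `R`, `R + a₁ / 2`, `R + a₂ / 2`. -/
abbrev Site (Γ : AddSubgroup (ℤ × ℤ)) := Cell Γ × Fin 3

section Kagome

variable (Γ : AddSubgroup (ℤ × ℤ))

/-- The six arrows `tail → head` attached to the cell `R`. The first three run counterclockwise
around the up triangle with vertices `R`, `R + a₁ / 2`, `R + a₂ / 2`; the last three run
counterclockwise around the down triangle with vertices `R`, `R - a₁ / 2`, `R - a₂ / 2`. Each
nearest neighbor bond of the Kagome lattice occurs exactly once. -/
def arrow (R : Cell Γ) : Fin 6 → Site Γ × Site Γ :=
  ![((R, 0), (R, 1)),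
    ((R, 1), (R, 2)),
    ((R, 2), (R, 0)),
    ((R, 0), (R - ((1, 0) : ℤ × ℤ), 1)),
    ((R - ((1, 0) : ℤ × ℤ), 1), (R - ((0, 1) : ℤ × ℤ), 2)),
    ((R - ((0, 1) : ℤ × ℤ), 2), (R, 0))]

variable [Γ.FiniteIndex]

/-- A torus has finitely many unit cells. -/
instance instFintypeCell : Fintype (Cell Γ) := Fintype.ofFinite _

open scoped Classical in
/-- The hopping matrix of `½ ∑_{i ← j} (i c†_i c_j + h.c.)`, the sum running over all arrows.
For `s = 1` the arrows circulate counterclockwise around every triangle, for `s = -1` they are all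
reversed, i.e. they circulate clockwise. -/
def kagomeHopping (s : ℤˣ) : Matrix (Site Γ) (Site Γ) ℂ := fun x y =>
  ∑ R : Cell Γ, ∑ b : Fin 6,
    ((if ((arrow Γ R b).2, (arrow Γ R b).1) = (x, y) then ((s : ℤ) : ℂ) * I / 2 else 0) +
      (if ((arrow Γ R b).1, (arrow Γ R b).2) = (x, y) then -(((s : ℤ) : ℂ) * I / 2) else 0))

open scoped Classical in
/-- The hopping matrix as an operator on the one-particle space. -/
def kagomeOp (s : ℤˣ) : EuclideanSpace ℂ (Site Γ) →ₗ[ℂ] EuclideanSpace ℂ (Site Γ) :=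
  Matrix.toEuclideanLin (kagomeHopping Γ s)

/-- `ψ` is a Bloch wave with crystal momentum given by the character `χ` of the translations. -/
def IsBloch (χ : AddChar (Cell Γ) ℂ) (ψ : EuclideanSpace ℂ (Site Γ)) : Prop :=
  ∀ (a R : Cell Γ) (α : Fin 3), ψ (R + a, α) = χ a * ψ (R, α)

/-- The band energies at the crystal momentum `χ`. -/
def bandEnergies (s : ℤˣ) (χ : AddChar (Cell Γ) ℂ) : Set ℝ :=
  {E | ∃ φ, IsBloch Γ χ φ ∧ φ ≠ 0 ∧ kagomeOp Γ s φ = (E : ℂ) • φ}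

/-- The lowest band: the span, over all crystal momenta, of the Bloch eigenstates of the lowest
energy at that momentum. -/
def lowestBand (s : ℤˣ) : Submodule ℂ (EuclideanSpace ℂ (Site Γ)) :=
  Submodule.span ℂ {ψ | ∃ (χ : AddChar (Cell Γ) ℂ) (E : ℝ), IsLeast (bandEnergies Γ s χ) E ∧
    IsBloch Γ χ ψ ∧ kagomeOp Γ s ψ = (E : ℂ) • ψ}

/-- The one-particle operator with the lowest band flattened to the energy `ε`: it is `ε` on the
lowest band and the original operator on the orthogonal complement (the other two bands). -/
def flattenedOp (s : ℤˣ) (ε : ℝ) :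
    EuclideanSpace ℂ (Site Γ) →ₗ[ℂ] EuclideanSpace ℂ (Site Γ) :=
  let P : EuclideanSpace ℂ (Site Γ) →ₗ[ℂ] EuclideanSpace ℂ (Site Γ) :=
    ((lowestBand Γ s).starProjection : EuclideanSpace ℂ (Site Γ) →L[ℂ] EuclideanSpace ℂ (Site Γ))
  (ε : ℂ) • P + kagomeOp Γ s ∘ₗ (LinearMap.id - P)

open scoped Classical in
/-- The matrix of `flattenedOp` in the site basis. -/
def flattenedHopping (s : ℤˣ) (ε : ℝ) : Matrix (Site Γ) (Site Γ) ℂ := fun x y =>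
  flattenedOp Γ s ε (EuclideanSpace.single y 1) x

end Kagome

end

/-! ### Canonical anticommutation relations, particle-number sectors and the spin lowering operator.
-/

section FockSpace

variable {Λ : Type*} [Fintype Λ]

/-! The argument is Mielke's: repulsion in a flat lowest band of `N` orbitals, filled with `N`
electrons, forces ferromagnetism as soon as the band projection `P` is irreducible as a matrix in
the site basis. On the Kagome torus irreducibility is read off from the nearest-neighbour entries of
`P`.

Many-body part. Write the hopping as `A + ε` with `A = Bᴴ B` and kernel equal to the band. In a
fixed sector `ε` only adds a constant, and the remaining energy is a sum of squares. The zero-energy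
states form `flatSpace A`: they are killed by the operators `∑_y A_{xy} c_{yσ}` and by `c_{x↑}
c_{x↓}`. On this space the `c_{yσ}` obey the linear relations of the rows of `P`, so `N` sites `b i`
carrying a row basis suffice, and `c_y = ∑ᵢ lam y i • c_{b i}`. Double occupancy being excluded, an
`N`-electron state is determined by its amplitudes with one spin at each `b i`. Expanding `c_{y↑}
c_{y↓} = 0` shows that spins `i` and `j` may be exchanged whenever `lam y i` and `lam y j` are both
nonzero (`spinAmplitude_swap`). If `P` is irreducible these transpositions generate the symmetric
group (`row_coefficients_connected`, `spinAmplitude_comp_perm`), so only the number of up spins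
matters and the dimension is at most `N + 1`. Removing electrons from the filled spin-up state
produces a polarized zero-energy state, whose multiplet already has dimension `N + 1`.

One-particle part. The Bloch matrix `h(χ)` has eigenvalues `0, ±E(χ)` with `E > 0`, hence `P(χ) =
(h² - E h) / (2 E²)`. Since `h(-χ) = -conj h(χ)`, the `h²` term contributes a real number to an
entry of `P` in position space, while on a bond the `h` term contributes `i` times a sum of terms of
one sign, nonzero at `χ = 0`. No bond entry used can therefore vanish, whatever the torus
(`lowMatrix_ne_zero`), and these bonds connect the lattice. -/

theorem modeRank_injective : Function.Injective (modeRank : Mode Λ → ℕ) := fun _ _ h =>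
  (Fintype.equivFin (Mode Λ)).injective (Fin.ext h)

open scoped Classical in
theorem modeSign_insert {m n : Mode Λ} {S : Finset (Mode Λ)} (h : n ∉ S) :
    modeSign m (insert n S) = (if modeRank n < modeRank m then -1 else 1) * modeSign m S := by
  unfold modeSign
  rw [Finset.filter_insert]
  split_ifs with h1
  · rw [Finset.card_insert_of_notMem (by simp [h]), pow_succ]; ring
  · simp

theorem modeSign_mul_self (m : Mode Λ) (S : Finset (Mode Λ)) :
    modeSign m S * modeSign m S = 1 := by
  unfold modeSign
  rw [← mul_pow]; simp

theorem star_modeSign (m : Mode Λ) (S : Finset (Mode Λ)) :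
    (starRingEnd ℂ) (modeSign m S) = modeSign m S := by
  unfold modeSign; simp

open scoped Classical in
theorem annihilate_apply (m : Mode Λ) (ψ : Fock Λ) (S : Finset (Mode Λ)) :
    annihilate m ψ S = if m ∈ S then 0 else modeSign m S * ψ (insert m S) := rfl

open scoped Classical in
theorem create_apply (m : Mode Λ) (ψ : Fock Λ) (S : Finset (Mode Λ)) :
    create m ψ S = if m ∈ S then modeSign m (S.erase m) * ψ (S.erase m) else 0 := by
  let D : Fock Λ →ₗ[ℂ] Fock Λ :=
    { toFun := fun ψ => WithLp.toLp 2 fun S =>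
        if m ∈ S then modeSign m (S.erase m) * ψ (S.erase m) else 0
      map_add' := fun ψ φ => by
        ext S
        by_cases h : m ∈ S <;> simp [h, mul_add]
      map_smul' := fun a ψ => by
        ext S
        by_cases h : m ∈ S <;> simp [h, mul_left_comm] }
  have hD : create m = D := by
    unfold create
    symm
    rw [LinearMap.eq_adjoint_iff]
    intro x y
    simp only [PiLp.inner_apply, RCLike.inner_apply]
    have e1 : ∀ S, y S * (starRingEnd ℂ) (D x S) = if m ∈ S then
        y S * (starRingEnd ℂ) (modeSign m (S.erase m) * x (S.erase m)) else 0 := by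
      intro S
      change y S * (starRingEnd ℂ) (if m ∈ S then _ else 0) = _
      split_ifs <;> simp
    have e2 : ∀ S, annihilate m y S * (starRingEnd ℂ) (x S) = if m ∉ S then
        modeSign m S * y (insert m S) * (starRingEnd ℂ) (x S) else 0 := by
      intro S
      rw [annihilate_apply]
      split_ifs <;> simp_all
    simp only [e1, e2]
    rw [← Finset.sum_filter, ← Finset.sum_filter]
    -- Erasing `m` matches the occupation sets containing `m` with those avoiding it, which
    -- identifies the two inner products.
    refine Finset.sum_bij' (fun S _ => S.erase m) (fun S _ => insert m S) ?_ ?_ ?_ ?_ ?_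
    · intro S; simp
    · intro S; simp
    · intro S hS; simp at hS; simp [Finset.insert_erase hS]
    · intro S hS; simp at hS; simp [Finset.erase_insert hS]
    · intro S hS
      simp only [Finset.mem_filter, Finset.mem_univ, true_and] at hS
      simp only [Finset.insert_erase hS, map_mul, star_modeSign]
      ring
  rw [hD]; rfl

/-- Of two distinct modes exactly one precedes the other, so exchanging the order of removal changes
exactly one of the two signs. -/
theorem annihilate_annihilate (m n : Mode Λ) (ψ : Fock Λ) :
    annihilate m (annihilate n ψ) = -annihilate n (annihilate m ψ) := by
  classical
  ext S
  rcases eq_or_ne m n with rfl | hmn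
  · simp [annihilate_apply]
  · have hr : modeRank m ≠ modeRank n := fun h => hmn (modeRank_injective h)
    simp only [annihilate_apply, PiLp.neg_apply, Finset.mem_insert, hmn, hmn.symm, false_or]
    by_cases hm : m ∈ S <;> by_cases hn : n ∈ S <;> simp only [hm, hn, if_true, if_false, neg_zero,
      mul_zero]
    rw [modeSign_insert hm, modeSign_insert hn, Finset.insert_comm]
    rcases lt_or_gt_of_ne hr with h | h
    · simp only [h, if_true, if_neg h.not_gt]; ring
    · simp only [h, if_true, if_neg h.not_gt]; ring

theorem annihilate_self (m : Mode Λ) (ψ : Fock Λ) : annihilate m (annihilate m ψ) = 0 := by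
  ext S
  simp [annihilate_apply]

open scoped Classical in
theorem annihilate_create (m n : Mode Λ) (ψ : Fock Λ) :
    annihilate m (create n ψ) = (if m = n then ψ else 0) - create n (annihilate m ψ) := by
  ext S
  rcases eq_or_ne m n with rfl | hmn
  · by_cases hm : m ∈ S
    · simp [annihilate_apply, create_apply, hm, Finset.insert_erase hm, ← mul_assoc,
        modeSign_mul_self]
    · simp [annihilate_apply, create_apply, hm, Finset.erase_insert hm, ← mul_assoc,
        modeSign_mul_self]
  · have hr : modeRank m ≠ modeRank n := fun h => hmn (modeRank_injective h)
    rw [if_neg hmn, zero_sub, PiLp.neg_apply, annihilate_apply, create_apply, create_apply,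
      annihilate_apply]
    by_cases hn : n ∈ S
    · by_cases hm : m ∈ S
      · simp [hm, hn, hmn]
      obtain ⟨T, hT, rfl⟩ : ∃ T, n ∉ T ∧ insert n T = S :=
        ⟨S.erase n, by simp, Finset.insert_erase hn⟩
      have hmT : m ∉ T := fun h => hm (Finset.mem_insert_of_mem h)
      have hnmT : n ∉ insert m T := by simp [hT, hmn.symm]
      rw [if_neg hm, if_pos (Finset.mem_insert_of_mem hn), if_pos hn, Finset.insert_comm,
        Finset.erase_insert hnmT, Finset.erase_insert hT, if_neg hmT,
        modeSign_insert hmT, modeSign_insert hT]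
      rcases lt_or_gt_of_ne hr with h | h
      · simp only [h, if_true, if_neg h.not_gt]; ring
      · simp only [h, if_true, if_neg h.not_gt]; ring
    · simp [hn, hmn.symm]

open scoped Classical in
theorem occupation_apply (m : Mode Λ) (ψ : Fock Λ) (S : Finset (Mode Λ)) :
    occupation m ψ S = if m ∈ S then ψ S else 0 := by
  change create m (annihilate m ψ) S = _
  rw [create_apply]
  split_ifs with h
  · simp [annihilate_apply, Finset.insert_erase h, ← mul_assoc, modeSign_mul_self]
  · rfl

theorem numberOp_apply (ψ : Fock Λ) (S : Finset (Mode Λ)) :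
    numberOp Λ ψ S = (S.card : ℂ) * ψ S := by
  classical
  simp [numberOp, LinearMap.sum_apply, occupation_apply]

theorem mem_sector_iff {n : ℕ} {ψ : Fock Λ} :
    ψ ∈ sector Λ n ↔ ∀ S, ψ S ≠ 0 → S.card = n := by
  rw [sector, Module.End.mem_eigenspace_iff]
  constructor
  · intro h S hS
    have := congrArg (fun f : Fock Λ => f S) h
    simp only [numberOp_apply, PiLp.smul_apply, smul_eq_mul] at this
    exact Nat.cast_injective (mul_right_cancel₀ hS this)
  · intro h
    ext S
    rw [numberOp_apply, PiLp.smul_apply, smul_eq_mul]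
    by_cases hS : ψ S = 0
    · simp [hS]
    · rw [h S hS]

theorem annihilate_mem_sector {n : ℕ} {ψ : Fock Λ} (h : ψ ∈ sector Λ (n + 1)) (m : Mode Λ) :
    annihilate m ψ ∈ sector Λ n := by
  classical
  rw [mem_sector_iff] at *
  intro S hS
  rw [annihilate_apply] at hS
  split_ifs at hS with hm
  · exact absurd rfl hS
  · have := h _ (right_ne_zero_of_mul hS)
    rw [Finset.card_insert_of_notMem hm] at this
    omega

theorem create_mem_sector {n : ℕ} {ψ : Fock Λ} (h : ψ ∈ sector Λ n) (m : Mode Λ) :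
    create m ψ ∈ sector Λ (n + 1) := by
  classical
  rw [mem_sector_iff] at *
  intro S hS
  rw [create_apply] at hS
  split_ifs at hS with hm
  · have := h _ (right_ne_zero_of_mul hS)
    rw [← Finset.card_erase_add_one hm, this]
  · exact absurd rfl hS

theorem annihilate_eq_zero_of_sector_zero {ψ : Fock Λ} (h : ψ ∈ sector Λ 0) (m : Mode Λ) :
    annihilate m ψ = 0 := by
  classical
  ext S
  rw [annihilate_apply]
  split_ifs with hm
  · rfl
  · have : ψ (insert m S) = 0 := by
      by_contra h'
      have := mem_sector_iff.1 h _ h'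
      simp at this
    simp [this]

theorem hop_mem_sector {n : ℕ} {ψ : Fock Λ} (h : ψ ∈ sector Λ n) (m m' : Mode Λ) :
    create m (annihilate m' ψ) ∈ sector Λ n := by
  cases n with
  | zero => rw [annihilate_eq_zero_of_sector_zero h, map_zero]; exact zero_mem _
  | succ n => exact create_mem_sector (annihilate_mem_sector h _) _

/-- A state annihilated by every mode has no component with electrons. -/
theorem eq_zero_of_annihilate_eq_zero {n : ℕ} {ψ : Fock Λ} (h : ψ ∈ sector Λ (n + 1))
    (h0 : ∀ m, annihilate m ψ = 0) : ψ = 0 := by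
  classical
  ext S
  by_contra hS
  have hc := mem_sector_iff.1 h S hS
  obtain ⟨m, hm⟩ : S.Nonempty := Finset.card_pos.1 (by omega)
  have := congrArg (fun f : Fock Λ => f (S.erase m)) (h0 m)
  simp only [annihilate_apply, Finset.mem_erase, ne_eq, not_true_eq_false, false_and, if_false,
    Finset.insert_erase hm, PiLp.zero_apply] at this
  rcases mul_eq_zero.1 this with h1 | h1
  · have := modeSign_mul_self m (S.erase m)
    rw [h1] at this; simp at this
  · exact hS h1

theorem eq_zero_of_vacuum_eq_zero {ψ : Fock Λ} (h : ψ ∈ sector Λ 0) (h0 : ψ ∅ = 0) : ψ = 0 := by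
  ext S
  by_contra hS
  have hc := mem_sector_iff.1 h S hS
  rw [Finset.card_eq_zero.1 hc] at hS
  exact hS h0

/-! ### The spin operators -/

theorem spinRaise_apply (ψ : Fock Λ) :
    spinRaise Λ ψ = ∑ x, create (x, true) (annihilate (x, false) ψ) := by
  simp [spinRaise, LinearMap.sum_apply]

theorem spinLower_apply (ψ : Fock Λ) :
    spinLower Λ ψ = ∑ x, create (x, false) (annihilate (x, true) ψ) := by
  simp [spinLower, LinearMap.sum_apply]

theorem spinLower_mem_sector {n : ℕ} {ψ : Fock Λ} (h : ψ ∈ sector Λ n) :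
    spinLower Λ ψ ∈ sector Λ n := by
  rw [spinLower_apply]
  exact Submodule.sum_mem _ fun x _ => hop_mem_sector h _ _

theorem annihilate_up_spinLower (y : Λ) (ψ : Fock Λ) :
    annihilate (y, true) (spinLower Λ ψ) = spinLower Λ (annihilate (y, true) ψ) := by
  simp only [spinLower_apply, map_sum]
  refine Finset.sum_congr rfl fun x _ => ?_
  rw [annihilate_create, if_neg (by simp), annihilate_annihilate (x, true)]
  simp

theorem annihilate_down_spinLower (y : Λ) (ψ : Fock Λ) :
    annihilate (y, false) (spinLower Λ ψ) =
      spinLower Λ (annihilate (y, false) ψ) + annihilate (y, true) ψ := by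
  classical
  simp only [spinLower_apply, map_sum]
  rw [← sub_eq_iff_eq_add', ← Finset.sum_sub_distrib]
  rw [Finset.sum_eq_single y]
  · rw [annihilate_create, if_pos rfl, annihilate_annihilate (y, true)]
    simp
  · intro x _ hx
    rw [annihilate_create, if_neg (by simp [hx.symm]), annihilate_annihilate (x, true)]
    simp
  · simp

/-- The commutator with `S⁻`, uniform in the spin; it is behind the stability of `flatSpace` under
`S⁻`. -/
theorem annihilate_spinLower (y : Λ) (σ : Bool) (ψ : Fock Λ) :
    annihilate (y, σ) (spinLower Λ ψ) = spinLower Λ (annihilate (y, σ) ψ) +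
      if σ then 0 else annihilate (y, true) ψ := by
  cases σ
  · simpa using annihilate_down_spinLower y ψ
  · simpa using annihilate_up_spinLower y ψ

end FockSpace

/-! ### Products of annihilation operators as alternating forms. -/

section Amplitudes

variable {Λ : Type*} [Fintype Λ]

/-- The annihilation operator `∑ₘ vₘ cₘ` attached to a vector of coefficients. -/
noncomputable def annihilateVec : (Mode Λ → ℂ) →ₗ[ℂ] Module.End ℂ (Fock Λ) :=
  Fintype.linearCombination ℂ (fun m => (annihilate m : Module.End ℂ (Fock Λ)))

theorem annihilateVec_apply (v : Mode Λ → ℂ) (ψ : Fock Λ) :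
    annihilateVec v ψ = ∑ m, v m • annihilate m ψ := by
  simp [annihilateVec, Fintype.linearCombination_apply, LinearMap.sum_apply]

open scoped Classical in
theorem annihilateVec_single (m : Mode Λ) :
    annihilateVec (Pi.single m 1) = (annihilate m : Module.End ℂ (Fock Λ)) := by
  simp [annihilateVec]

theorem annihilate_annihilateVec (m : Mode Λ) (v : Mode Λ → ℂ) (ψ : Fock Λ) :
    annihilate m (annihilateVec v ψ) = -annihilateVec v (annihilate m ψ) := by
  simp only [annihilateVec_apply, map_sum, map_smul, ← Finset.sum_neg_distrib]
  exact Finset.sum_congr rfl fun n _ => by rw [annihilate_annihilate, smul_neg]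

theorem annihilateVec_annihilateVec (v w : Mode Λ → ℂ) (ψ : Fock Λ) :
    annihilateVec v (annihilateVec w ψ) = -annihilateVec w (annihilateVec v ψ) := by
  rw [annihilateVec_apply v, annihilateVec_apply v ψ, map_sum, ← Finset.sum_neg_distrib]
  refine Finset.sum_congr rfl fun n _ => ?_
  rw [annihilate_annihilateVec, map_smul, smul_neg]

/-- This is the relation required for the exterior algebra to act on Fock space, which makes the
amplitudes alternating. -/
theorem annihilateVec_mul_self (v : Mode Λ → ℂ) : annihilateVec v * annihilateVec v = 0 := by
  ext1 ψ
  have h := annihilateVec_annihilateVec v v ψ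
  have h2 : (2 : ℂ) • annihilateVec v (annihilateVec v ψ) = 0 := by
    rw [two_smul]
    nth_rewrite 1 [h]
    exact neg_add_cancel _
  exact (smul_eq_zero.1 h2).resolve_left two_ne_zero

theorem annihilateVec_mem_sector {n : ℕ} {ψ : Fock Λ} (h : ψ ∈ sector Λ (n + 1))
    (v : Mode Λ → ℂ) : annihilateVec v ψ ∈ sector Λ n := by
  rw [annihilateVec_apply]
  exact Submodule.sum_mem _ fun m _ => Submodule.smul_mem _ _ (annihilate_mem_sector h m)

/-- The vacuum component of `c(v₁) ⋯ c(vₙ) ψ` as an alternating form in `v₁, …, vₙ`. -/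
noncomputable def amplitude (n : ℕ) (ψ : Fock Λ) : (Mode Λ → ℂ) [⋀^Fin n]→ₗ[ℂ] ℂ :=
  LinearMap.compAlternatingMap
    ((EuclideanSpace.proj (∅ : Finset (Mode Λ)) : Fock Λ →L[ℂ] ℂ).toLinearMap ∘ₗ
      LinearMap.applyₗ ψ ∘ₗ
      (ExteriorAlgebra.lift ℂ ⟨annihilateVec, annihilateVec_mul_self⟩).toLinearMap)
    (ExteriorAlgebra.ιMulti ℂ n)

theorem amplitude_apply (n : ℕ) (ψ : Fock Λ) (v : Fin n → Mode Λ → ℂ) :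
    amplitude n ψ v = ((List.ofFn v).map annihilateVec).prod ψ ∅ := by
  simp only [amplitude, LinearMap.compAlternatingMap_apply, ExteriorAlgebra.ιMulti_apply,
    LinearMap.comp_apply, AlgHom.toLinearMap_apply, map_list_prod, List.map_ofFn,
    LinearMap.applyₗ_apply_apply]
  have : (ExteriorAlgebra.lift ℂ ⟨annihilateVec, annihilateVec_mul_self⟩ ∘
      fun i => ExteriorAlgebra.ι ℂ (v i)) = (annihilateVec : (Mode Λ → ℂ) →ₗ[ℂ] _) ∘ v := by
    funext i
    simp
  rw [this]
  rfl

theorem annihilateVec_prod_mem {𝒢 : Submodule ℂ (Fock Λ)}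
    (hinv : ∀ v, ∀ φ ∈ 𝒢, annihilateVec v φ ∈ 𝒢) {ψ : Fock Λ} (hψ : ψ ∈ 𝒢)
    (l : List (Mode Λ → ℂ)) : (l.map annihilateVec).prod ψ ∈ 𝒢 := by
  induction l with
  | nil => simpa using hψ
  | cons v l ih => simpa using hinv v _ ih

/-- A product of annihilation operators vanishes on an invariant subspace if one factor does. -/
theorem annihilateVec_prod_eq_zero_of_mem {𝒢 : Submodule ℂ (Fock Λ)}
    (hinv : ∀ v, ∀ φ ∈ 𝒢, annihilateVec v φ ∈ 𝒢) {ψ : Fock Λ} (hψ : ψ ∈ 𝒢)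
    {l : List (Mode Λ → ℂ)} {v : Mode Λ → ℂ} (hv : v ∈ l)
    (h0 : ∀ φ ∈ 𝒢, annihilateVec v φ = 0) : (l.map annihilateVec).prod ψ = 0 := by
  obtain ⟨l₁, l₂, rfl⟩ := List.append_of_mem hv
  simp only [List.map_append, List.map_cons, List.prod_append, List.prod_cons,
    Module.End.mul_apply]
  rw [h0 _ (annihilateVec_prod_mem hinv hψ l₂), map_zero]

/-- In a product of annihilation operators each factor can be moved to the front. -/
theorem exists_annihilateVec_prod_eq {𝒢 : Submodule ℂ (Fock Λ)}
    (hinv : ∀ v, ∀ φ ∈ 𝒢, annihilateVec v φ ∈ 𝒢) {ψ : Fock Λ} (hψ : ψ ∈ 𝒢)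
    {l : List (Mode Λ → ℂ)} {v : Mode Λ → ℂ} (hv : v ∈ l) :
    ∃ φ ∈ 𝒢, (l.map annihilateVec).prod ψ = annihilateVec v φ := by
  induction l with
  | nil => simp at hv
  | cons w l ih =>
    rcases List.mem_cons.1 hv with rfl | h
    · exact ⟨_, annihilateVec_prod_mem hinv hψ l, by simp⟩
    · obtain ⟨φ, hφ, e⟩ := ih h
      refine ⟨-annihilateVec w φ, neg_mem (hinv w φ hφ), ?_⟩
      rw [List.map_cons, List.prod_cons, Module.End.mul_apply, e, annihilateVec_annihilateVec,
        map_neg]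

/-- A product of annihilation operators vanishes on an invariant subspace if the product of two
of its factors does. -/
theorem annihilateVec_prod_eq_zero_of_pair {𝒢 : Submodule ℂ (Fock Λ)}
    (hinv : ∀ v, ∀ φ ∈ 𝒢, annihilateVec v φ ∈ 𝒢) {ψ : Fock Λ} (hψ : ψ ∈ 𝒢)
    {l : List (Mode Λ → ℂ)} {v w : Mode Λ → ℂ} (hvw : v ≠ w) (hv : v ∈ l) (hw : w ∈ l)
    (h0 : ∀ φ ∈ 𝒢, annihilateVec v (annihilateVec w φ) = 0) :
    (l.map annihilateVec).prod ψ = 0 := by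
  induction l with
  | nil => simp at hv
  | cons u l ih =>
    rw [List.map_cons, List.prod_cons, Module.End.mul_apply]
    rcases List.mem_cons.1 hv with rfl | hv'
    · obtain ⟨φ, hφ, e⟩ := exists_annihilateVec_prod_eq hinv hψ
        ((List.mem_cons.1 hw).resolve_left hvw.symm)
      rw [e, h0 φ hφ]
    · rcases List.mem_cons.1 hw with rfl | hw'
      · obtain ⟨φ, hφ, e⟩ := exists_annihilateVec_prod_eq hinv hψ hv'
        rw [e, annihilateVec_annihilateVec, h0 φ hφ, neg_zero]
      · rw [ih hv' hw', map_zero]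

end Amplitudes

/-! ### Exchange symmetry of the spin amplitudes and the bound on the degeneracy. -/

section SpinSymmetry

open scoped Classical

variable {Λ : Type*} [Fintype Λ] {𝒢 : Submodule ℂ (Fock Λ)} {N : ℕ} {b : Fin N → Λ}
  {lam : Λ → Fin N → ℂ}

/-- If the states of an invariant subspace are determined by annihilating in the modes at the
sites `b i`, they are determined by their amplitudes at these modes. -/
theorem eq_zero_of_amplitude_eq_zero
    (hinv : ∀ v, ∀ φ ∈ 𝒢, annihilateVec v φ ∈ 𝒢)
    (hlam : ∀ φ ∈ 𝒢, ∀ y τ, annihilate (y, τ) φ = ∑ i, lam y i • annihilate (b i, τ) φ)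
    {n : ℕ} {ψ : Fock Λ} (hψ : ψ ∈ 𝒢) (hn : ψ ∈ sector Λ n)
    (h0 : ∀ u : Fin n → Fin N × Bool,
      amplitude n ψ (fun k => Pi.single (b (u k).1, (u k).2) 1) = 0) : ψ = 0 := by
  induction n generalizing ψ with
  | zero =>
    refine eq_zero_of_vacuum_eq_zero hn ?_
    simpa [amplitude_apply] using h0 Fin.elim0
  | succ n ih =>
    have key : ∀ i τ, annihilate (b i, τ) ψ = 0 := by
      intro i τ
      refine ih ?_ (annihilate_mem_sector hn _) fun u => ?_
      · have := hinv (Pi.single (b i, τ) 1) ψ hψ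
        rwa [annihilateVec_single] at this
      -- The rightmost factor acts first on `ψ`, so the mode already annihilated is appended as the
      -- last entry.
      · have := h0 (Fin.snoc u (i, τ))
        rw [amplitude_apply, List.ofFn_succ'] at this
        simpa [amplitude_apply, annihilateVec_single] using this
    refine eq_zero_of_annihilate_eq_zero hn fun m => ?_
    rw [hlam ψ hψ m.1 m.2]
    simp [key]

/-- Two electrons at one site are excluded by the Pauli principle if their spins agree and by
`hpair` if they differ. -/
theorem amplitude_eq_zero_of_not_injective
    (hinv : ∀ v, ∀ φ ∈ 𝒢, annihilateVec v φ ∈ 𝒢)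
    (hpair : ∀ φ ∈ 𝒢, ∀ y, annihilate (y, true) (annihilate (y, false) φ) = 0)
    {n : ℕ} {ψ : Fock Λ} (hψ : ψ ∈ 𝒢) {x : Fin n → Λ} (σ : Fin n → Bool)
    (hx : ¬ Function.Injective x) :
    amplitude n ψ (fun k => Pi.single (x k, σ k) 1) = 0 := by
  simp only [Function.Injective, not_forall] at hx
  obtain ⟨p, q, hpq, hne⟩ := hx
  by_cases hσ : σ p = σ q
  · exact (amplitude n ψ).map_eq_zero_of_eq _ (by simp [hpq, hσ]) hne
  · rw [amplitude_apply]
    have hmem : ∀ τ, Pi.single (x p, τ) (1 : ℂ) ∈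
        List.ofFn (fun k => (Pi.single (x k, σ k) (1 : ℂ) : Mode Λ → ℂ)) := by
      intro τ
      rw [List.mem_ofFn]
      by_cases h : σ p = τ
      · exact ⟨p, by simp [h]⟩
      · refine ⟨q, ?_⟩
        have : σ q = τ := by
          cases hp : σ p <;> cases hq : σ q <;> cases τ <;> simp_all
        simp [this, hpq]
    rw [annihilateVec_prod_eq_zero_of_pair hinv hψ (v := Pi.single (x p, true) 1)
      (w := Pi.single (x p, false) 1) ?_ (hmem true) (hmem false) ?_]
    · rfl
    · intro h
      have := congrFun h (x p, true)
      simp at this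
    · intro φ hφ
      simpa [annihilateVec_single] using hpair φ hφ (x p)

/-- By `hlam` the difference of the two sides comes from a vector whose annihilator vanishes on all
of `𝒢`; a product containing it is zero, and multilinearity does the rest. -/
theorem amplitude_update_single
    (hinv : ∀ v, ∀ φ ∈ 𝒢, annihilateVec v φ ∈ 𝒢)
    (hlam : ∀ φ ∈ 𝒢, ∀ y τ, annihilate (y, τ) φ = ∑ i, lam y i • annihilate (b i, τ) φ)
    {n : ℕ} {ψ : Fock Λ} (hψ : ψ ∈ 𝒢) (v : Fin n → Mode Λ → ℂ) (j : Fin n) (y : Λ) (τ : Bool) :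
    amplitude n ψ (Function.update v j (Pi.single (y, τ) 1)) =
      ∑ i, lam y i * amplitude n ψ (Function.update v j (Pi.single (b i, τ) 1)) := by
  have h : amplitude n ψ (Function.update v j
      (Pi.single (y, τ) 1 - ∑ i, lam y i • Pi.single (b i, τ) 1)) = 0 := by
    rw [amplitude_apply, annihilateVec_prod_eq_zero_of_mem hinv hψ
      (v := Pi.single (y, τ) 1 - ∑ i, lam y i • Pi.single (b i, τ) 1)]
    · rfl
    · exact List.mem_ofFn.2 ⟨j, by simp⟩
    · intro φ hφ
      simp only [map_sub, map_sum, map_smul, annihilateVec_single, LinearMap.sub_apply,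
        LinearMap.sum_apply, LinearMap.smul_apply]
      rw [hlam φ hφ y τ, sub_self]
  rw [AlternatingMap.map_update_sub, AlternatingMap.map_update_sum, sub_eq_zero] at h
  rw [h]
  exact Finset.sum_congr rfl fun i _ => by rw [AlternatingMap.map_update_smul, smul_eq_mul]

/-- The amplitude of the state with one electron of spin `σ i` at each site `b i`. -/
noncomputable def spinAmplitude (b : Fin N → Λ) (ψ : Fock Λ) (σ : Fin N → Bool) : ℂ :=
  amplitude N ψ (fun k => Pi.single (b k, σ k) 1)

/-- Put both the up electron of slot `i` and the down electron of slot `j` at `y`: the amplitude is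
zero. Expanding both slots over the sites `b k`, only the assignments `(i, j)` and `(j, i)` avoid
the sites held by the other electrons and each other; antisymmetry turns the second into minus the
amplitude with exchanged spins. -/
theorem spinAmplitude_swap_aux
    (hinv : ∀ v, ∀ φ ∈ 𝒢, annihilateVec v φ ∈ 𝒢)
    (hlam : ∀ φ ∈ 𝒢, ∀ y τ, annihilate (y, τ) φ = ∑ i, lam y i • annihilate (b i, τ) φ)
    (hpair : ∀ φ ∈ 𝒢, ∀ y, annihilate (y, true) (annihilate (y, false) φ) = 0)
    {ψ : Fock Λ} (hψ : ψ ∈ 𝒢) {y : Λ} {i j : Fin N} (hij : i ≠ j)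
    (hi : lam y i ≠ 0) (hj : lam y j ≠ 0) (σ : Fin N → Bool) (σi : σ i = true)
    (σj : σ j = false) :
    spinAmplitude b ψ (σ ∘ Equiv.swap i j) = spinAmplitude b ψ σ := by
  let F : (Fin N → Fin N) → ℂ := fun u => amplitude N ψ (fun k => Pi.single (b (u k), σ k) 1)
  have hF0 : ∀ u : Fin N → Fin N, ¬ Function.Injective u → F u = 0 := fun u hu =>
    amplitude_eq_zero_of_not_injective hinv hpair hψ (x := b ∘ u) σ
      fun h => hu (Function.Injective.of_comp h)
  have hzero : amplitude N ψ (Function.update (Function.update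
      (fun k => Pi.single (b k, σ k) 1) i (Pi.single (y, true) 1)) j
        (Pi.single (y, false) 1)) = 0 := by
    have := amplitude_eq_zero_of_not_injective hinv hpair hψ
      (x := Function.update (Function.update b i y) j y) σ
      (fun h => hij (h (by simp [hij])))
    convert this using 2
    ext1 k
    rcases eq_or_ne k j with rfl | hkj
    · simp [σj]
    · rcases eq_or_ne k i with rfl | hki
      · simp [σi, hkj]
      · simp [hkj, hki]
  have hexp : ∑ l, ∑ k, lam y l * (lam y k *
      F (Function.update (Function.update id i k) j l)) = 0 := by
    rw [← hzero, amplitude_update_single hinv hlam hψ]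
    refine Finset.sum_congr rfl fun l _ => ?_
    rw [Function.update_comm hij, amplitude_update_single hinv hlam hψ, Finset.mul_sum]
    refine Finset.sum_congr rfl fun k _ => ?_
    congr 2
    dsimp only [F]
    congr 1
    ext1 m
    rcases eq_or_ne m j with rfl | hkj
    · simp [σj, hij.symm]
    · rcases eq_or_ne m i with rfl | hki
      · simp [σi, hkj]
      · simp [hkj, hki]
  -- All slots other than `i` and `j` keep their own site, so an injective reassignment can only
  -- permute these two.
  have hinj : ∀ k l, Function.Injective (Function.update (Function.update id i k) j l) →
      (k = i ∧ l = j) ∨ (k = j ∧ l = i) := by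
    intro k l hu
    have h1 : k = i ∨ k = j := by
      by_contra! h
      exact h.1 (hu (a₁ := k) (a₂ := i) (by simp [h.1, h.2, hij]))
    have h2 : l = i ∨ l = j := by
      by_contra! h
      exact h.2 (hu (a₁ := l) (a₂ := j) (by simp [h.1, h.2]))
    have h3 : k ≠ l := by
      rintro rfl
      exact hij (hu (a₁ := i) (a₂ := j) (by simp [hij]))
    rcases h1 with h1 | h1 <;> rcases h2 with h2 | h2
    · exact absurd (h1.trans h2.symm) h3
    · exact Or.inl ⟨h1, h2⟩
    · exact Or.inr ⟨h1, h2⟩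
    · exact absurd (h1.trans h2.symm) h3
  have hsum : lam y j * (lam y i * F (Function.update (Function.update id i i) j j)) +
      lam y i * (lam y j * F (Function.update (Function.update id i j) j i)) = 0 := by
    rw [← hexp, ← Finset.sum_subset (Finset.subset_univ {j, i}), Finset.sum_pair hij.symm]
    · congr 1
      · rw [Finset.sum_eq_single i]
        · intro k _ hk
          rw [hF0 _ fun h => (hinj _ _ h).elim (fun h => hk h.1) fun h => hij h.2.symm,
            mul_zero, mul_zero]
        · simp
      · rw [Finset.sum_eq_single j]
        · intro k _ hk
          rw [hF0 _ fun h => (hinj _ _ h).elim (fun h => hij h.2) fun h => hk h.1, mul_zero, mul_zero]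
        · simp
    · intro l _ hl
      refine Finset.sum_eq_zero fun k _ => ?_
      rw [hF0 _ fun h => (hinj _ _ h).elim (fun h => hl (by simp [h.2]))
        fun h => hl (by simp [h.2]), mul_zero, mul_zero]
  have e1 : F (Function.update (Function.update id i i) j j) = spinAmplitude b ψ σ := by
    dsimp only [F, spinAmplitude]
    congr 1
    ext1 m
    rcases eq_or_ne m j with rfl | hkj
    · simp
    · rcases eq_or_ne m i with rfl | hki
      · simp [hkj]
      · simp [hkj, hki]
  have e2 : F (Function.update (Function.update id i j) j i) =
      -spinAmplitude b ψ (σ ∘ Equiv.swap i j) := by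
    rw [spinAmplitude, ← AlternatingMap.map_swap _ _ hij]
    dsimp only [F]
    congr 1
    ext1 m
    rcases eq_or_ne m j with rfl | hkj
    · simp
    · rcases eq_or_ne m i with rfl | hki
      · simp [hkj]
      · simp [hkj, hki, Equiv.swap_apply_of_ne_of_ne]
  rw [e1, e2] at hsum
  have : lam y i * lam y j * (spinAmplitude b ψ σ - spinAmplitude b ψ (σ ∘ Equiv.swap i j)) = 0 := by
    linear_combination hsum
  have := (mul_eq_zero.1 this).resolve_left (mul_ne_zero hi hj)
  exact (sub_eq_zero.1 this).symm

theorem spinAmplitude_swap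
    (hinv : ∀ v, ∀ φ ∈ 𝒢, annihilateVec v φ ∈ 𝒢)
    (hlam : ∀ φ ∈ 𝒢, ∀ y τ, annihilate (y, τ) φ = ∑ i, lam y i • annihilate (b i, τ) φ)
    (hpair : ∀ φ ∈ 𝒢, ∀ y, annihilate (y, true) (annihilate (y, false) φ) = 0)
    {ψ : Fock Λ} (hψ : ψ ∈ 𝒢) {y : Λ} {i j : Fin N}
    (hi : lam y i ≠ 0) (hj : lam y j ≠ 0) (σ : Fin N → Bool) :
    spinAmplitude b ψ (σ ∘ Equiv.swap i j) = spinAmplitude b ψ σ := by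
  rcases eq_or_ne i j with rfl | hij
  · simp
  by_cases h : σ i = σ j
  · congr 1
    ext1 m
    rcases eq_or_ne m j with rfl | hkj
    · simp [h]
    · rcases eq_or_ne m i with rfl | hki
      · simp [h]
      · simp [hkj, hki, Equiv.swap_apply_of_ne_of_ne]
  · cases σi : σ i
    · rw [Equiv.swap_comm]
      refine spinAmplitude_swap_aux hinv hlam hpair hψ hij.symm hj hi σ ?_ σi
      cases hh : σ j
      · exact absurd (σi.trans hh.symm) h
      · rfl
    · refine spinAmplitude_swap_aux hinv hlam hpair hψ hij hi hj σ σi ?_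
      cases hh : σ j
      · rfl
      · exact absurd (σi.trans hh.symm) h

/-- If the coefficient vectors `lam y` cannot be split into two groups with supports in disjoint
nonempty sets, the amplitudes do not depend on the order of the spins. -/
theorem spinAmplitude_comp_perm
    (hinv : ∀ v, ∀ φ ∈ 𝒢, annihilateVec v φ ∈ 𝒢)
    (hlam : ∀ φ ∈ 𝒢, ∀ y τ, annihilate (y, τ) φ = ∑ i, lam y i • annihilate (b i, τ) φ)
    (hpair : ∀ φ ∈ 𝒢, ∀ y, annihilate (y, true) (annihilate (y, false) φ) = 0)
    (hconn : ∀ K : Set (Fin N), (∀ y, ∀ i ∈ K, lam y i ≠ 0 → ∀ j, lam y j ≠ 0 → j ∈ K) →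
      K = ∅ ∨ K = Set.univ)
    {ψ : Fock Λ} (hψ : ψ ∈ 𝒢) (σ : Fin N → Bool) (g : Equiv.Perm (Fin N)) :
    spinAmplitude b ψ (σ ∘ g) = spinAmplitude b ψ σ := by
  let G : Subgroup (Equiv.Perm (Fin N)) :=
    { carrier := {g | ∀ σ, spinAmplitude b ψ (σ ∘ g) = spinAmplitude b ψ σ}
      mul_mem' := fun {g h} hg hh σ => by
        rw [Equiv.Perm.coe_mul, ← Function.comp_assoc, hh, hg]
      one_mem' := fun σ => rfl
      inv_mem' := fun {g} hg σ => by
        rw [← hg (σ ∘ ⇑g⁻¹)]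
        congr 1
        ext k
        simp }
  have hswap : ∀ i j, Equiv.swap i j ∈ G := by
    intro i j
    -- The partners of `i` form a set to which `hconn` applies: if `k` is a partner and some `y`
    -- links `k` to `l`, conjugating one transposition by the other makes `l` a partner.
    have hK := hconn {j | Equiv.swap i j ∈ G} (fun y k hk hyk l hyl => by
      have h1 : Equiv.swap k l ∈ G := fun σ => spinAmplitude_swap hinv hlam hpair hψ hyk hyl σ
      change Equiv.swap i l ∈ G
      rcases eq_or_ne k l with rfl | hkl
      · exact hk
      rcases eq_or_ne i k with rfl | hik
      · exact h1
      rcases eq_or_ne i l with rfl | hil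
      · rw [Equiv.swap_self]; exact G.one_mem
      · have : Equiv.swap i l = Equiv.swap k l * Equiv.swap i k * Equiv.swap k l := by
          rw [Equiv.swap_mul_swap_mul_swap hik hil, Equiv.swap_comm]
        rw [this]
        exact G.mul_mem (G.mul_mem h1 hk) h1)
    rcases hK with h | h
    · have : i ∈ ({j | Equiv.swap i j ∈ G} : Set (Fin N)) := by
        change Equiv.swap i i ∈ G
        rw [Equiv.swap_self]; exact G.one_mem
      rw [h] at this
      exact this.elim
    · have : j ∈ ({j | Equiv.swap i j ∈ G} : Set (Fin N)) := by rw [h]; trivial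
      exact this
  have htop : G = ⊤ := by
    rw [eq_top_iff, ← Equiv.Perm.closure_isSwap, Subgroup.closure_le]
    rintro g ⟨i, j, -, rfl⟩
    exact hswap i j
  have : g ∈ G := by rw [htop]; trivial
  exact this σ

/-- A state of the invariant subspace with `N` electrons vanishes if its spin amplitudes do. -/
theorem eq_zero_of_spinAmplitude_eq_zero
    (hinv : ∀ v, ∀ φ ∈ 𝒢, annihilateVec v φ ∈ 𝒢)
    (hlam : ∀ φ ∈ 𝒢, ∀ y τ, annihilate (y, τ) φ = ∑ i, lam y i • annihilate (b i, τ) φ)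
    (hpair : ∀ φ ∈ 𝒢, ∀ y, annihilate (y, true) (annihilate (y, false) φ) = 0)
    {ψ : Fock Λ} (hψ : ψ ∈ 𝒢) (hN : ψ ∈ sector Λ N) (h0 : ∀ σ, spinAmplitude b ψ σ = 0) :
    ψ = 0 := by
  refine eq_zero_of_amplitude_eq_zero hinv hlam hψ hN fun u => ?_
  by_cases hu : Function.Injective (Prod.fst ∘ u)
  · let g : Equiv.Perm (Fin N) := Equiv.ofBijective _ (Finite.injective_iff_bijective.1 hu)
    have h1 := (amplitude N ψ).map_perm
      (fun k => Pi.single (b (u (g⁻¹ k)).1, (u (g⁻¹ k)).2) 1) g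
    have h2 : spinAmplitude b ψ (fun k => (u (g⁻¹ k)).2) = amplitude N ψ
        (fun k => Pi.single (b (u (g⁻¹ k)).1, (u (g⁻¹ k)).2) 1) := by
      unfold spinAmplitude
      congr 1
      ext1 k
      have : (u (g⁻¹ k)).1 = k := g.apply_symm_apply k
      rw [this]
    rw [← h2, h0, smul_zero] at h1
    rw [← h1]
    congr 1
    ext1 k
    simp
  · exact amplitude_eq_zero_of_not_injective hinv hpair hψ (x := fun k => b (u k).1) _
      fun h => hu (Function.Injective.of_comp (f := b) h)

/-- A nonzero state of the invariant subspace has at most `N` electrons. -/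
theorem eq_zero_of_lt_sector
    (hinv : ∀ v, ∀ φ ∈ 𝒢, annihilateVec v φ ∈ 𝒢)
    (hlam : ∀ φ ∈ 𝒢, ∀ y τ, annihilate (y, τ) φ = ∑ i, lam y i • annihilate (b i, τ) φ)
    (hpair : ∀ φ ∈ 𝒢, ∀ y, annihilate (y, true) (annihilate (y, false) φ) = 0)
    {n : ℕ} (hn : N < n) {ψ : Fock Λ} (hψ : ψ ∈ 𝒢) (hs : ψ ∈ sector Λ n) : ψ = 0 := by
  refine eq_zero_of_amplitude_eq_zero hinv hlam hψ hs fun u => ?_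
  refine amplitude_eq_zero_of_not_injective hinv hpair hψ (x := fun k => b (u k).1) _ fun h => ?_
  have := Fintype.card_le_of_injective _
    (Function.Injective.of_comp (f := b) (g := fun k => (u k).1) h)
  simp at this
  omega

theorem exists_perm_comp_eq {σ σ' : Fin N → Bool}
    (h : (Finset.univ.filter (σ · = true)).card = (Finset.univ.filter (σ' · = true)).card) :
    ∃ g : Equiv.Perm (Fin N), σ = σ' ∘ g := by
  have e : {i // σ i = true} ≃ {i // σ' i = true} :=
    Fintype.equivOfCardEq (by rw [Fintype.card_subtype, Fintype.card_subtype, h])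
  refine ⟨e.extendSubtype, ?_⟩
  ext1 i
  by_cases hi : σ i = true
  · rw [Function.comp_apply, hi, e.extendSubtype_mem i hi]
  · have := e.extendSubtype_not_mem i hi
    simp only [Bool.not_eq_true] at hi this
    rw [Function.comp_apply, hi, this]

theorem finrank_le_of_spinAmplitude
    (hinv : ∀ v, ∀ φ ∈ 𝒢, annihilateVec v φ ∈ 𝒢)
    (hlam : ∀ φ ∈ 𝒢, ∀ y τ, annihilate (y, τ) φ = ∑ i, lam y i • annihilate (b i, τ) φ)
    (hpair : ∀ φ ∈ 𝒢, ∀ y, annihilate (y, true) (annihilate (y, false) φ) = 0)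
    (hconn : ∀ K : Set (Fin N), (∀ y, ∀ i ∈ K, lam y i ≠ 0 → ∀ j, lam y j ≠ 0 → j ∈ K) →
      K = ∅ ∨ K = Set.univ) :
    Module.finrank ℂ ↥(sector Λ N ⊓ 𝒢) ≤ N + 1 := by
  -- One representative spin configuration for each number `k = 0, …, N` of up spins.
  let s : Fin (N + 1) → Fin N → Bool := fun k i => decide (i.val < k.val)
  have hs : ∀ k, (Finset.univ.filter (s k · = true)).card = k.val := by
    intro k
    have : Finset.univ.filter (s k · = true) = Finset.univ.filter (fun i : Fin N => i.val < k) := by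
      ext; simp [s]
    rw [this, Fin.card_filter_val_lt]
    omega
  let L : ↥(sector Λ N ⊓ 𝒢) →ₗ[ℂ] (Fin (N + 1) → ℂ) :=
    { toFun := fun ψ k => spinAmplitude b ψ (s k)
      map_add' := fun ψ φ => by
        ext k; simp [spinAmplitude, amplitude_apply]
      map_smul' := fun c ψ => by
        ext k; simp [spinAmplitude, amplitude_apply] }
  have hL : Function.Injective L := by
    rw [injective_iff_map_eq_zero]
    rintro ⟨ψ, hψN, hψ⟩ h
    ext1
    refine eq_zero_of_spinAmplitude_eq_zero hinv hlam hpair hψ hψN fun σ => ?_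
    have hc : (Finset.univ.filter (σ · = true)).card < N + 1 := by
      have := Finset.card_le_univ (Finset.univ.filter (σ · = true))
      simp at this; omega
    obtain ⟨g, hg⟩ := exists_perm_comp_eq (σ := σ) (σ' := s ⟨_, hc⟩) (by rw [hs])
    rw [hg, spinAmplitude_comp_perm hinv hlam hpair hconn hψ]
    exact congrFun h _
  simpa using LinearMap.finrank_le_finrank_of_injective hL

end SpinSymmetry

/-! ### The spin algebra and the multiplet of a polarized state. -/

section SpinMultiplet

variable {Λ : Type*} [Fintype Λ]

theorem spinZ_apply (ψ : Fock Λ) : spinZ Λ ψ = (1 / 2 : ℂ) •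
    ∑ x, (occupation (x, true) ψ - occupation (x, false) ψ) := by
  simp [spinZ, LinearMap.sum_apply]

theorem numberOp_eq (ψ : Fock Λ) : numberOp Λ ψ =
    ∑ x, (occupation (x, true) ψ + occupation (x, false) ψ) := by
  simp [numberOp, LinearMap.sum_apply, Fintype.sum_prod_type]

open scoped Classical in
theorem spinZ_apply_apply (ψ : Fock Λ) (S : Finset (Mode Λ)) : spinZ Λ ψ S =
    (1 / 2 : ℂ) * (∑ x, ((if (x, true) ∈ S then 1 else 0) - if (x, false) ∈ S then 1 else 0)) *
      ψ S := by
  rw [spinZ_apply, PiLp.smul_apply, smul_eq_mul, mul_assoc, Finset.sum_mul]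
  congr 1
  rw [WithLp.ofLp_sum, Finset.sum_apply]
  refine Finset.sum_congr rfl fun x _ => ?_
  rw [PiLp.sub_apply, occupation_apply, occupation_apply]
  split_ifs <;> ring

theorem create_create (m n : Mode Λ) (ψ : Fock Λ) :
    create m (create n ψ) = -create n (create m ψ) := by
  have h : annihilate n ∘ₗ annihilate m =
      -((annihilate m : Fock Λ →ₗ[ℂ] Fock Λ) ∘ₗ annihilate n) := by
    ext1 φ
    exact annihilate_annihilate n m φ
  have h2 := congrArg LinearMap.adjoint h
  rw [map_neg, LinearMap.adjoint_comp, LinearMap.adjoint_comp] at h2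
  exact LinearMap.congr_fun h2 ψ

theorem spinLower_create_up (x : Λ) (ψ : Fock Λ) :
    spinLower Λ (create (x, true) ψ) = create (x, true) (spinLower Λ ψ) + create (x, false) ψ := by
  classical
  simp only [spinLower_apply, map_sum]
  rw [← sub_eq_iff_eq_add', ← Finset.sum_sub_distrib, Finset.sum_eq_single x]
  · rw [annihilate_create, if_pos rfl, map_sub, create_create (x, false)]
    simp
  · intro y _ hy
    rw [annihilate_create, if_neg (by simp [hy]), zero_sub, map_neg, create_create (y, false)]
    simp
  · simp

theorem spinRaise_spinLower (ψ : Fock Λ) :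
    spinRaise Λ (spinLower Λ ψ) = spinLower Λ (spinRaise Λ ψ) + (2 : ℂ) • spinZ Λ ψ := by
  rw [spinRaise_apply (spinLower Λ ψ), spinRaise_apply ψ, spinZ_apply, smul_smul, map_sum]
  rw [show (2 : ℂ) * (1 / 2) = 1 by norm_num, one_smul, ← Finset.sum_add_distrib]
  refine Finset.sum_congr rfl fun x _ => ?_
  rw [annihilate_down_spinLower, map_add, spinLower_create_up]
  change _ = _ + (create (x, true) (annihilate (x, true) ψ) -
    create (x, false) (annihilate (x, false) ψ))
  abel

theorem spinZ_spinLower (ψ : Fock Λ) :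
    spinZ Λ (spinLower Λ ψ) = spinLower Λ (spinZ Λ ψ) - spinLower Λ ψ := by
  classical
  rw [spinLower_apply, map_sum, spinLower_apply, ← Finset.sum_sub_distrib]
  refine Finset.sum_congr rfl fun x _ => ?_
  ext S
  rw [spinZ_apply_apply, PiLp.sub_apply, create_apply, create_apply]
  split_ifs with h
  · rw [annihilate_apply, annihilate_apply, spinZ_apply_apply]
    split_ifs with h'
    · simp
    · have hx : (x, true) ∉ S := by simpa using h'
      have hsum : ∀ y, ((if (y, true) ∈ insert (x, true) (S.erase (x, false)) then (1 : ℂ) else 0) -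
          if (y, false) ∈ insert (x, true) (S.erase (x, false)) then 1 else 0) =
          ((if (y, true) ∈ S then 1 else 0) - if (y, false) ∈ S then 1 else 0) +
            if y = x then 2 else 0 := by
        intro y
        rcases eq_or_ne y x with rfl | hy
        · simp [h, hx]; norm_num
        · simp [hy]
      simp only [hsum, Finset.sum_add_distrib, Finset.sum_ite_eq', Finset.mem_univ, if_true]
      ring
  · simp

/-- A highest weight state: all `n` electrons have spin up. -/
structure IsPolarized (n : ℕ) (ψ : Fock Λ) : Prop where
  ne_zero : ψ ≠ 0
  mem_sector : ψ ∈ sector Λ n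
  annihilate_down : ∀ x, annihilate (x, false) ψ = 0

namespace IsPolarized

variable {n : ℕ} {ψ : Fock Λ}

theorem spinRaise_eq_zero (h : IsPolarized n ψ) : spinRaise Λ ψ = 0 := by
  simp [spinRaise_apply, h.annihilate_down]

theorem spinZ_eq (h : IsPolarized n ψ) : spinZ Λ ψ = ((n : ℂ) / 2) • ψ := by
  have h1 : numberOp Λ ψ = (n : ℂ) • ψ := Module.End.mem_eigenspace_iff.1 h.mem_sector
  have h2 : ∀ x, occupation (x, false) ψ = 0 := fun x => by
    rw [occupation, LinearMap.comp_apply, h.annihilate_down, map_zero]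
  rw [numberOp_eq, Finset.sum_congr rfl fun x _ => by rw [h2, add_zero]] at h1
  rw [spinZ_apply, Finset.sum_congr rfl fun x _ => by rw [h2, sub_zero], h1, smul_smul]
  congr 1
  ring

theorem spinZ_pow (h : IsPolarized n ψ) (k : ℕ) : spinZ Λ ((spinLower Λ ^ k) ψ) =
    ((n : ℂ) / 2 - k) • (spinLower Λ ^ k) ψ := by
  induction k with
  | zero => simpa using h.spinZ_eq
  | succ k ih =>
    rw [pow_succ', Module.End.mul_apply, spinZ_spinLower, ih, map_smul]
    push_cast
    module

/-- The usual ladder computation with `[S⁺, S⁻] = 2 Sᶻ`. The factor is nonzero for `k < n`, so the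
first `n + 1` states of the chain are nonzero. -/
theorem spinRaise_pow (h : IsPolarized n ψ) (k : ℕ) :
    spinRaise Λ ((spinLower Λ ^ (k + 1)) ψ) =
      (((k : ℂ) + 1) * (n - k)) • (spinLower Λ ^ k) ψ := by
  induction k with
  | zero =>
    have := spinRaise_spinLower ψ
    rw [h.spinRaise_eq_zero, map_zero, h.spinZ_eq] at this
    simp only [zero_add, pow_one, pow_zero, Module.End.one_apply, this]
    push_cast
    module
  | succ k ih =>
    rw [pow_succ', Module.End.mul_apply, spinRaise_spinLower, ih, h.spinZ_pow, map_smul,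
      ← Module.End.mul_apply (spinLower Λ), ← pow_succ']
    push_cast
    module

theorem pow_ne_zero (h : IsPolarized n ψ) {k : ℕ} (hk : k ≤ n) : (spinLower Λ ^ k) ψ ≠ 0 := by
  induction k with
  | zero => simpa using h.ne_zero
  | succ k ih =>
    intro h0
    have h1 := h.spinRaise_pow k
    rw [h0, map_zero] at h1
    rcases smul_eq_zero.1 h1.symm with h2 | h2
    · rcases mul_eq_zero.1 h2 with h3 | h3
      · exact Nat.cast_add_one_ne_zero k h3
      · have : (n : ℂ) = k := sub_eq_zero.1 h3
        have : n = k := by exact_mod_cast this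
        omega
    · exact ih (by omega) h2

theorem spinSq_pow (h : IsPolarized n ψ) (k : ℕ) : spinSq Λ ((spinLower Λ ^ k) ψ) =
    ((n : ℂ) / 2 * ((n : ℂ) / 2 + 1)) • (spinLower Λ ^ k) ψ := by
  have h0 : spinLower Λ (spinRaise Λ ((spinLower Λ ^ k) ψ)) =
      ((k : ℂ) * (n - k + 1)) • (spinLower Λ ^ k) ψ := by
    cases k with
    | zero => simp [h.spinRaise_eq_zero]
    | succ k =>
      rw [h.spinRaise_pow, map_smul, ← Module.End.mul_apply (spinLower Λ), ← pow_succ']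
      push_cast
      module
  simp only [spinSq, LinearMap.add_apply, LinearMap.smul_apply, LinearMap.comp_apply]
  rw [spinRaise_spinLower, h0, h.spinZ_pow, map_smul, h.spinZ_pow]
  module

theorem linearIndependent_pow (h : IsPolarized n ψ) :
    LinearIndependent ℂ (fun k : Fin (n + 1) => (spinLower Λ ^ (k : ℕ)) ψ) := by
  refine Module.End.eigenvectors_linearIndependent' (spinZ Λ)
    (fun k : Fin (n + 1) => (n : ℂ) / 2 - (k : ℕ)) ?_ _ ?_
  · intro k l hkl
    have : ((k : ℕ) : ℂ) = (l : ℕ) := by simpa using hkl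
    exact Fin.ext (by exact_mod_cast this)
  · intro k
    exact ⟨Module.End.mem_eigenspace_iff.2 (h.spinZ_pow k), h.pow_ne_zero (by omega)⟩

/-- A space of states that is invariant under `S⁻`, contains a polarized state of `n` electrons and
has dimension at most `n + 1` is a single multiplet of total spin `n / 2`. -/
theorem multiplet (h : IsPolarized n ψ) {V : Submodule ℂ (Fock Λ)} (hψ : ψ ∈ V)
    (hV : ∀ φ ∈ V, spinLower Λ φ ∈ V) (hdim : Module.finrank ℂ V ≤ n + 1) :
    (∀ φ ∈ V, spinSq Λ φ = ((n : ℂ) / 2 * ((n : ℂ) / 2 + 1)) • φ) ∧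
      Module.finrank ℂ V = n + 1 := by
  have hmem : ∀ k : ℕ, (spinLower Λ ^ k) ψ ∈ V := by
    intro k
    induction k with
    | zero => simpa using hψ
    | succ k ih =>
      rw [pow_succ', Module.End.mul_apply]
      exact hV _ ih
  have hle : Submodule.span ℂ (Set.range fun k : Fin (n + 1) => (spinLower Λ ^ (k : ℕ)) ψ) ≤ V := by
    rw [Submodule.span_le]
    rintro _ ⟨k, rfl⟩
    exact hmem k
  have hspan := finrank_span_eq_card h.linearIndependent_pow
  rw [Fintype.card_fin] at hspan
  -- The `n + 1` independent lowered states exhaust `V` because of the dimension bound.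
  have heq := Submodule.eq_of_le_of_finrank_le hle (by rw [hspan]; exact hdim)
  refine ⟨?_, by rw [← heq, hspan]⟩
  intro φ hφ
  rw [← heq] at hφ
  have : Submodule.span ℂ (Set.range fun k : Fin (n + 1) => (spinLower Λ ^ (k : ℕ)) ψ) ≤
      Module.End.eigenspace (spinSq Λ) ((n : ℂ) / 2 * ((n : ℂ) / 2 + 1)) := by
    rw [Submodule.span_le]
    rintro _ ⟨k, rfl⟩
    exact Module.End.mem_eigenspace_iff.2 (h.spinSq_pow k)
  exact Module.End.mem_eigenspace_iff.1 (this hφ)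

end IsPolarized

end SpinMultiplet

/-! ### The space of zero-energy states. -/

section FlatSpace

variable {Λ : Type*} [Fintype Λ]

/-- The vector of mode coefficients with spatial part `w` and spin `σ`. -/
def spinVec (σ : Bool) : (Λ → ℂ) →ₗ[ℂ] (Mode Λ → ℂ) where
  toFun w m := if m.2 = σ then w m.1 else 0
  map_add' v w := by
    ext m
    by_cases h : m.2 = σ <;> simp [h]
  map_smul' a w := by
    ext m
    by_cases h : m.2 = σ <;> simp [h]

theorem annihilateVec_spinVec (σ : Bool) (w : Λ → ℂ) (ψ : Fock Λ) :
    annihilateVec (spinVec σ w) ψ = ∑ y, w y • annihilate (y, σ) ψ := by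
  rw [annihilateVec_apply, Fintype.sum_prod_type]
  refine Finset.sum_congr rfl fun y _ => ?_
  rw [Finset.sum_eq_single σ]
  · simp [spinVec]
  · intro τ _ hτ
    simp [spinVec, hτ]
  · simp

theorem annihilateVec_spinLower (σ : Bool) (w : Λ → ℂ) (ψ : Fock Λ) :
    annihilateVec (spinVec σ w) (spinLower Λ ψ) =
      spinLower Λ (annihilateVec (spinVec σ w) ψ) +
        if σ then 0 else annihilateVec (spinVec true w) ψ := by
  simp only [annihilateVec_spinVec, annihilate_spinLower, smul_add, Finset.sum_add_distrib, map_sum,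
    map_smul]
  cases σ <;> simp

/-- The states annihilated by the operators `∑_y A_{xy} c_{yσ}` and `c_{x↑} c_{x↓}`. -/
noncomputable def flatSpace (A : Matrix Λ Λ ℂ) : Submodule ℂ (Fock Λ) :=
  (⨅ x, ⨅ σ, LinearMap.ker (annihilateVec (spinVec σ (A x)))) ⊓
    ⨅ x, LinearMap.ker (annihilate (x, true) ∘ₗ annihilate (x, false))

theorem mem_flatSpace {A : Matrix Λ Λ ℂ} {ψ : Fock Λ} : ψ ∈ flatSpace A ↔
    (∀ x σ, annihilateVec (spinVec σ (A x)) ψ = 0) ∧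
      ∀ x, annihilate (x, true) (annihilate (x, false) ψ) = 0 := by
  simp [flatSpace, Submodule.mem_inf, Submodule.mem_iInf]

theorem annihilateVec_mem_flatSpace {A : Matrix Λ Λ ℂ} (v : Mode Λ → ℂ) {ψ : Fock Λ}
    (h : ψ ∈ flatSpace A) : annihilateVec v ψ ∈ flatSpace A := by
  rw [mem_flatSpace] at *
  refine ⟨fun x σ => ?_, fun x => ?_⟩
  · rw [annihilateVec_annihilateVec, h.1, map_zero, neg_zero]
  · rw [annihilate_annihilateVec, map_neg, annihilate_annihilateVec, h.2, map_zero, neg_zero,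
      neg_zero]

/-- Commuting `S⁻` past a defining condition leaves either the same condition for spin up or `c_{x↑}
c_{x↑} = 0`. -/
theorem spinLower_mem_flatSpace {A : Matrix Λ Λ ℂ} {ψ : Fock Λ}
    (h : ψ ∈ flatSpace A) : spinLower Λ ψ ∈ flatSpace A := by
  rw [mem_flatSpace] at *
  refine ⟨fun x σ => ?_, fun x => ?_⟩
  · rw [annihilateVec_spinLower, h.1, h.1, map_zero, ite_self, add_zero]
  · rw [annihilate_down_spinLower, map_add, annihilate_up_spinLower, h.2, map_zero,
      annihilate_self, add_zero]

theorem annihilateVec_vecMul {A : Matrix Λ Λ ℂ} {ψ : Fock Λ} (h : ψ ∈ flatSpace A) (u : Λ → ℂ)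
    (σ : Bool) : annihilateVec (spinVec σ (Matrix.vecMul u A)) ψ = 0 := by
  rw [Matrix.vecMul_eq_sum, map_sum, map_sum, LinearMap.sum_apply]
  refine Finset.sum_eq_zero fun x _ => ?_
  rw [map_smul, map_smul, LinearMap.smul_apply, (mem_flatSpace.1 h).1, smul_zero]

end FlatSpace

/-! ### The Hubbard energy as a sum of squares. -/

section Energy

variable {Λ : Type*} [Fintype Λ]

open scoped InnerProductSpace

theorem inner_create (m : Mode Λ) (φ ψ : Fock Λ) :
    ⟪φ, create m ψ⟫_ℂ = ⟪annihilate m φ, ψ⟫_ℂ := by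
  rw [create, LinearMap.adjoint_inner_right]

theorem hubbard_apply (t : Matrix Λ Λ ℂ) (U : ℝ) (ψ : Fock Λ) : hubbard t U ψ =
    (∑ x, ∑ σ, create (x, σ) (annihilateVec (spinVec σ (t x)) ψ)) +
      (U : ℂ) • ∑ x, occupation (x, true) (occupation (x, false) ψ) := by
  simp only [hubbard, LinearMap.add_apply, LinearMap.sum_apply, LinearMap.smul_apply,
    LinearMap.comp_apply, annihilateVec_spinVec, map_sum, map_smul]
  congr 1
  exact Finset.sum_congr rfl fun x _ => Finset.sum_comm

/-- On a sector the extra term is a constant, so the band energy can be shifted to zero. -/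
theorem hubbard_add_smul_one [DecidableEq Λ] (A : Matrix Λ Λ ℂ) (ε : ℂ) (U : ℝ) (ψ : Fock Λ) :
    hubbard (A + ε • 1) U ψ = hubbard A U ψ + ε • numberOp Λ ψ := by
  have h : ∀ x : Λ, (A + ε • (1 : Matrix Λ Λ ℂ)) x = A x + ε • Pi.single x 1 := by
    intro x
    ext y
    simp [Matrix.one_apply, Pi.single_apply, eq_comm]
  simp only [hubbard_apply, h, map_add, map_smul, LinearMap.add_apply, LinearMap.smul_apply,
    Finset.sum_add_distrib]
  have h2 : ∀ (x : Λ) σ, annihilateVec (spinVec σ (Pi.single x 1)) ψ = annihilate (x, σ) ψ := by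
    intro x σ
    rw [annihilateVec_spinVec, Finset.sum_eq_single x] <;> simp +contextual
  have h3 : numberOp Λ ψ = ∑ x : Λ, ∑ σ, create (x, σ) (annihilate (x, σ) ψ) := by
    rw [numberOp, LinearMap.sum_apply, Fintype.sum_prod_type]
    rfl
  simp only [h2, h3, Finset.smul_sum]
  abel

theorem hubbard_eq_zero {A : Matrix Λ Λ ℂ} (U : ℝ) {ψ : Fock Λ} (h : ψ ∈ flatSpace A) :
    hubbard A U ψ = 0 := by
  rw [mem_flatSpace] at h
  rw [hubbard_apply]
  have h2 : ∀ x, occupation (x, true) (occupation (x, false) ψ) = 0 := by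
    intro x
    rw [occupation, occupation, LinearMap.comp_apply, LinearMap.comp_apply, annihilate_create,
      if_neg (by simp), h.2]
    simp
  simp [h.1, h2]

/-- With `A = Bᴴ B` the hopping term is `∑ c(B z)† c(B z)`, and the interaction is likewise a sum of
`D† D` with `D = c_{x↑} c_{x↓}`. For `U > 0` the energy is nonnegative and vanishes only if every
term does. -/
theorem inner_hubbard {A B : Matrix Λ Λ ℂ} (hB : A = B.conjTranspose * B) (U : ℝ) (ψ : Fock Λ) :
    ⟪ψ, hubbard A U ψ⟫_ℂ =
      (((∑ σ, ∑ z, ‖annihilateVec (spinVec σ (B z)) ψ‖ ^ 2) +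
        U * ∑ x, ‖annihilate (x, true) (annihilate (x, false) ψ)‖ ^ 2 : ℝ) : ℂ) := by
  rw [hubbard_apply, inner_add_right, inner_smul_right, inner_sum, inner_sum]
  push_cast
  congr 1
  · simp only [inner_sum, inner_create]
    rw [Finset.sum_comm]
    refine Finset.sum_congr rfl fun σ _ => ?_
    have h1 : ∀ x, A x = ∑ z, (starRingEnd ℂ) (B z x) • B z := by
      intro x
      ext y
      rw [hB, Matrix.mul_apply, Finset.sum_apply]
      rfl
    have h2 : ∀ z, ((‖annihilateVec (spinVec σ (B z)) ψ‖ : ℂ)) ^ 2 =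
        ∑ x, (starRingEnd ℂ) (B z x) *
          ⟪annihilate (x, σ) ψ, annihilateVec (spinVec σ (B z)) ψ⟫_ℂ := by
      intro z
      have := inner_self_eq_norm_sq_to_K (𝕜 := ℂ) (annihilateVec (spinVec σ (B z)) ψ)
      rw [show ((‖annihilateVec (spinVec σ (B z)) ψ‖ : ℂ)) ^ 2 = _ from this.symm]
      nth_rewrite 1 [annihilateVec_spinVec]
      rw [sum_inner]
      exact Finset.sum_congr rfl fun x _ => inner_smul_left _ _ _
    simp only [h1, h2, map_sum, map_smul, LinearMap.sum_apply, LinearMap.smul_apply, inner_sum,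
      inner_smul_right]
    exact Finset.sum_comm
  · congr 1
    refine Finset.sum_congr rfl fun x _ => ?_
    rw [occupation, occupation, LinearMap.comp_apply, LinearMap.comp_apply, inner_create,
      annihilate_create, if_neg (by simp), zero_sub, inner_neg_right, inner_create,
      annihilate_annihilate (x, false), inner_neg_left, neg_neg]
    exact inner_self_eq_norm_sq_to_K (𝕜 := ℂ) _

theorem mem_flatSpace_of_inner_eq_zero {A B : Matrix Λ Λ ℂ} (hB : A = B.conjTranspose * B) {U : ℝ}
    (hU : 0 < U) {ψ : Fock Λ} (h : ⟪ψ, hubbard A U ψ⟫_ℂ = 0) : ψ ∈ flatSpace A := by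
  rw [inner_hubbard hB, Complex.ofReal_eq_zero] at h
  have n1 : 0 ≤ ∑ σ, ∑ z, ‖annihilateVec (spinVec σ (B z)) ψ‖ ^ 2 := by positivity
  have n2 : 0 ≤ ∑ x, ‖annihilate (x, true) (annihilate (x, false) ψ)‖ ^ 2 := by positivity
  have e1 : ∑ σ, ∑ z, ‖annihilateVec (spinVec σ (B z)) ψ‖ ^ 2 = 0 := by nlinarith
  have e2 : ∑ x, ‖annihilate (x, true) (annihilate (x, false) ψ)‖ ^ 2 = 0 := by nlinarith
  have k1 : ∀ σ z, annihilateVec (spinVec σ (B z)) ψ = 0 := by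
    intro σ z
    rw [Finset.sum_eq_zero_iff_of_nonneg (fun _ _ => by positivity)] at e1
    have := e1 σ (Finset.mem_univ _)
    rw [Finset.sum_eq_zero_iff_of_nonneg (fun _ _ => by positivity)] at this
    simpa using this z (Finset.mem_univ _)
  rw [mem_flatSpace]
  refine ⟨fun x σ => ?_, fun x => ?_⟩
  · have h1 : A x = ∑ z, (starRingEnd ℂ) (B z x) • B z := by
      ext y
      rw [hB, Matrix.mul_apply, Finset.sum_apply]
      rfl
    rw [h1, map_sum, map_sum, LinearMap.sum_apply]
    refine Finset.sum_eq_zero fun z _ => ?_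
    rw [map_smul, map_smul, LinearMap.smul_apply, k1, smul_zero]
  · rw [Finset.sum_eq_zero_iff_of_nonneg (fun _ _ => by positivity)] at e2
    simpa using e2 x (Finset.mem_univ _)

variable [DecidableEq Λ]

theorem hubbard_apply_of_mem_sector (A : Matrix Λ Λ ℂ) (ε U : ℝ) {n : ℕ} {ψ : Fock Λ}
    (h : ψ ∈ sector Λ n) : hubbard (A + (ε : ℂ) • 1) U ψ =
      hubbard A U ψ + ((ε * n : ℝ) : ℂ) • ψ := by
  rw [hubbard_add_smul_one, Module.End.mem_eigenspace_iff.1 h, smul_smul]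
  push_cast
  rfl

theorem levelSpace_eq_flatSpace {A B : Matrix Λ Λ ℂ} (hB : A = B.conjTranspose * B) (ε : ℝ) {U : ℝ}
    (hU : 0 < U) (n : ℕ) :
    levelSpace (hubbard (A + (ε : ℂ) • 1) U) n (ε * n) = sector Λ n ⊓ flatSpace A := by
  ext ψ
  simp only [levelSpace, Submodule.mem_inf, Module.End.mem_eigenspace_iff]
  refine and_congr_right fun hs => ?_
  rw [hubbard_apply_of_mem_sector A ε U hs, add_eq_right]
  refine ⟨fun h => mem_flatSpace_of_inner_eq_zero hB hU ?_, hubbard_eq_zero U⟩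
  rw [h, inner_zero_right]

theorem isLeast_energyLevels {A B : Matrix Λ Λ ℂ} (hB : A = B.conjTranspose * B) (ε : ℝ) {U : ℝ}
    (hU : 0 < U) {n : ℕ} {ψ : Fock Λ} (hψ : ψ ≠ 0) (hs : ψ ∈ sector Λ n) (hf : ψ ∈ flatSpace A) :
    IsLeast (energyLevels (hubbard (A + (ε : ℂ) • 1) U) n) (ε * n) := by
  constructor
  · refine ⟨ψ, hs, hψ, ?_⟩
    rw [hubbard_apply_of_mem_sector A ε U hs, hubbard_eq_zero U hf, zero_add]
  · rintro E ⟨φ, hφs, hφ0, hφ⟩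
    rw [hubbard_apply_of_mem_sector A ε U hφs] at hφ
    have h1 : hubbard A U φ = ((E - ε * n : ℝ) : ℂ) • φ := by
      rw [Complex.ofReal_sub, sub_smul, ← hφ, add_sub_cancel_right]
    have h2 := inner_hubbard hB U φ
    rw [h1, inner_smul_right, inner_self_eq_norm_sq_to_K (𝕜 := ℂ)] at h2
    have h4 : 0 ≤ (E - ε * n) * ‖φ‖ ^ 2 := by
      have h3 : (((E - ε * n) * ‖φ‖ ^ 2 : ℝ) : ℂ) = _ := (by push_cast; rfl : _ = _).trans h2
      rw [Complex.ofReal_injective h3]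
      positivity
    have h5 : 0 < ‖φ‖ ^ 2 := by positivity
    have := nonneg_of_mul_nonneg_left h4 h5
    linarith

end Energy

/-! ### Row bases of a projection, irreducibility and Mielke's theorem. -/

section Irreducible

variable {Λ : Type*} [Fintype Λ]

theorem exists_row_basis (P : Matrix Λ Λ ℂ) {N : ℕ} (hN : P.rank = N) :
    ∃ (b : Fin N → Λ) (lam : Λ → Fin N → ℂ), LinearIndependent ℂ (fun i => P (b i)) ∧
      ∀ y, P y = ∑ i, lam y i • P (b i) := by
  obtain ⟨κ, a, ha, hsp, hli⟩ := exists_linearIndependent' ℂ (fun y => P y)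
  have : Finite κ := Finite.of_injective a ha
  have : Fintype κ := Fintype.ofFinite κ
  have hc : Fintype.card κ = N := by
    rw [← finrank_span_eq_card hli, hsp, ← hN, Matrix.rank_eq_finrank_span_row]
    rfl
  let e : Fin N ≃ κ := (Fintype.equivFinOfCardEq hc).symm
  have hmem : ∀ y, ∃ c : κ → ℂ, ∑ k, c k • P (a k) = P y := by
    intro y
    have : P y ∈ Submodule.span ℂ (Set.range ((fun y => P y) ∘ a)) := by
      rw [hsp]
      exact Submodule.subset_span ⟨y, rfl⟩
    exact (Submodule.mem_span_range_iff_exists_fun ℂ).1 this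
  choose c hc' using hmem
  refine ⟨a ∘ e, fun y i => c y (e i), hli.comp e e.injective, fun y => ?_⟩
  rw [← hc' y]
  exact (Equiv.sum_comp e (fun k => c y k • P (a k))).symm

theorem rank_eq_of_trace [DecidableEq Λ] {P : Matrix Λ Λ ℂ} (hP : P * P = P) {N : ℕ}
    (ht : P.trace = N) : P.rank = N := by
  have h1 : IsIdempotentElem (Matrix.toLin' P) := by
    rw [IsIdempotentElem, Module.End.mul_eq_comp, ← Matrix.toLin'_mul, hP]
  have h2 := (LinearMap.isProj_range_iff_isIdempotentElem _).2 h1 |>.trace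
  rw [Matrix.trace_toLin'_eq, ht] at h2
  exact (Nat.cast_injective h2).symm

/-- The coefficients of the rows of an irreducible projection with respect to a basis consisting
of rows cannot be split into two groups with disjoint supports. -/
theorem row_coefficients_connected {P : Matrix Λ Λ ℂ} (hP : P * P = P) (hPh : P.IsHermitian)
    (hirr : ∀ S : Set Λ, (∀ x ∈ S, ∀ y ∉ S, P x y = 0) → S = ∅ ∨ S = Set.univ)
    {N : ℕ} {b : Fin N → Λ} {lam : Λ → Fin N → ℂ} (hli : LinearIndependent ℂ (fun i => P (b i)))
    (hlam : ∀ y, P y = ∑ i, lam y i • P (b i)) (K : Set (Fin N))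
    (hK : ∀ y, ∀ i ∈ K, lam y i ≠ 0 → ∀ j, lam y j ≠ 0 → j ∈ K) : K = ∅ ∨ K = Set.univ := by
  classical
  -- Row `b i` is its own expansion; this lets a statement about `S` be carried back to `K` at the
  -- end.
  have hb : ∀ i, lam (b i) = Pi.single i 1 := by
    intro i
    have h : ∑ j, (lam (b i) j - (Pi.single i 1 : Fin N → ℂ) j) • P (b j) = 0 := by
      simp only [sub_smul, Finset.sum_sub_distrib, ← hlam]
      simp [Pi.single_apply]
    have := Fintype.linearIndependent_iff.1 hli _ h
    ext j
    exact sub_eq_zero.1 (this j)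
  let S : Set Λ := {y | ∃ i ∈ K, lam y i ≠ 0}
  have hSK : ∀ y ∈ S, ∀ i ∉ K, lam y i = 0 := by
    rintro y ⟨k, hk, hyk⟩ i hi
    by_contra h
    exact hi (hK y k hk hyk i h)
  have hSK' : ∀ y ∉ S, ∀ i ∈ K, lam y i = 0 := by
    intro y hy i hi
    by_contra h
    exact hy ⟨i, hi, h⟩
  have hrow : ∀ x, P x = ∑ y, P x y • P y := by
    intro x
    ext z
    have := congrFun (congrFun hP x) z
    rw [← this, Matrix.mul_apply, Finset.sum_apply]
    rfl
  have hcoef : ∀ x i, lam x i = ∑ y, P x y * lam y i := by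
    intro x i
    have h : ∑ i, (lam x i - ∑ y, P x y * lam y i) • P (b i) = 0 := by
      simp only [sub_smul, Finset.sum_sub_distrib, ← hlam, Finset.sum_smul, mul_smul]
      rw [Finset.sum_comm]
      simp only [← Finset.smul_sum, ← hlam, ← hrow, sub_self]
    exact sub_eq_zero.1 (Fintype.linearIndependent_iff.1 hli _ h i)
  -- In the coefficient form of `P = P * P`, the sites outside `S` contribute nothing: on `K` their
  -- coefficients vanish, and off `K` they carry the whole sum, which is `lam x i = 0`. So the part
  -- of row `x` outside `S` is mapped to zero by `P`.
  have hS : ∀ x ∈ S, ∀ y ∉ S, P x y = 0 := by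
    intro x hx
    have h0 : ∀ i, ∑ y, (if y ∈ S then 0 else P x y) * lam y i = 0 := by
      intro i
      by_cases hi : i ∈ K
      · refine Finset.sum_eq_zero fun y _ => ?_
        split_ifs with hy
        · simp
        · rw [hSK' y hy i hi, mul_zero]
      · refine Eq.trans ?_ ((hcoef x i).symm.trans (hSK x hx i hi))
        refine Finset.sum_congr rfl fun y _ => ?_
        split_ifs with hy
        · rw [hSK y hy i hi, mul_zero, mul_zero]
        · rfl
    have h1 : ∑ y, (if y ∈ S then 0 else P x y) • P y = 0 := by
      have : ∀ y, (if y ∈ S then 0 else P x y) • P y =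
          ∑ i, ((if y ∈ S then 0 else P x y) * lam y i) • P (b i) := by
        intro y
        refine (congrArg (_ • ·) (hlam y)).trans ?_
        simp only [Finset.smul_sum, mul_smul]
      rw [Finset.sum_congr rfl fun y _ => this y, Finset.sum_comm]
      simp only [← Finset.sum_smul, h0, zero_smul, Finset.sum_const_zero]
    have h2 : ∑ y, (if y ∈ S then 0 else ‖P x y‖ ^ 2) = 0 := by
      -- At column `x` Hermiticity turns `P x y * P y x` into `‖P x y‖ ^ 2`, so each term must
      -- vanish.
      have h3 := congrFun h1 x
      rw [Finset.sum_apply] at h3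
      have h4 : ∀ y, ((if y ∈ S then 0 else P x y) • P y) x =
          ((if y ∈ S then 0 else ‖P x y‖ ^ 2 : ℝ) : ℂ) := by
        intro y
        rw [Pi.smul_apply, smul_eq_mul, ← hPh.apply y x]
        split_ifs
        · simp
        · rw [Complex.star_def, Complex.mul_conj, Complex.normSq_eq_norm_sq]
      rw [Finset.sum_congr rfl fun y _ => h4 y] at h3
      refine Complex.ofReal_injective ?_
      rw [Complex.ofReal_sum, h3]
      simp
    intro y hy
    rw [Finset.sum_eq_zero_iff_of_nonneg (fun _ _ => by split_ifs <;> positivity)] at h2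
    simpa [hy] using h2 y (Finset.mem_univ _)
  rcases hirr S hS with h | h
  · left
    by_contra hne
    obtain ⟨i, hi⟩ := Set.nonempty_iff_ne_empty.2 hne
    have : b i ∈ S := ⟨i, hi, by simp [hb]⟩
    rw [h] at this
    exact this
  · right
    ext i
    refine ⟨fun _ => trivial, fun _ => ?_⟩
    have : b i ∈ S := by rw [h]; trivial
    obtain ⟨k, hk, hne⟩ := this
    rw [hb, Pi.single_apply] at hne
    rcases eq_or_ne k i with rfl | hki
    · exact hk
    · simp [hki] at hne

/-- Removing spin-up electrons from the completely filled spin-up state. -/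
theorem exists_polarized_of_list (l : List (Λ → ℂ)) :
    ∃ (n : ℕ) (ψ : Fock Λ), IsPolarized n ψ ∧ Fintype.card Λ ≤ n + l.length ∧
      ∀ r ∈ l, annihilateVec (spinVec true r) ψ = 0 := by
  classical
  induction l with
  | nil =>
    let F : Finset (Mode Λ) := Finset.univ.image fun x => (x, true)
    refine ⟨Fintype.card Λ, EuclideanSpace.single F 1, ⟨?_, ?_, ?_⟩, by simp, by simp⟩
    · intro h
      simpa using congrArg (fun f : Fock Λ => f F) h
    · rw [mem_sector_iff]
      intro S hS
      have : S = F := by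
        by_contra h
        simp [h] at hS
      rw [this, Finset.card_image_of_injective _ (fun a b h => (Prod.mk.inj h).1),
        Finset.card_univ]
    · intro x
      ext S
      rw [annihilate_apply]
      split_ifs with h
      · rfl
      · have : insert (x, false) S ≠ F := by
          intro h
          have h2 : (x, false) ∈ F := h ▸ Finset.mem_insert_self _ _
          simp [F] at h2
        simp [this]
  | cons r l ih =>
    obtain ⟨n, ψ, hψ, hn, hl⟩ := ih
    by_cases h : annihilateVec (spinVec true r) ψ = 0
    · refine ⟨n, ψ, hψ, by simp; omega, ?_⟩
      intro s hs
      rcases List.mem_cons.1 hs with rfl | hs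
      · exact h
      · exact hl s hs
    · cases n with
      -- With no electron left the annihilator would give zero, against `h`; so a nonzero removal
      -- always has an electron to remove.
      | zero =>
        refine absurd ?_ h
        rw [annihilateVec_apply]
        exact Finset.sum_eq_zero fun m _ => by
          rw [annihilate_eq_zero_of_sector_zero hψ.mem_sector, smul_zero]
      | succ n =>
        refine ⟨n, _, ⟨h, annihilateVec_mem_sector hψ.mem_sector _, fun x => ?_⟩,
          by simp; omega, ?_⟩
        · rw [annihilate_annihilateVec, hψ.annihilate_down, map_zero, neg_zero]
        · intro s hs
          rw [annihilateVec_annihilateVec]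
          rcases List.mem_cons.1 hs with rfl | hs
          · rw [neg_eq_zero]
            exact LinearMap.congr_fun (annihilateVec_mul_self (spinVec true s)) ψ
          · rw [hl s hs, map_zero, neg_zero]

/-- Mielke's theorem: if the lowest one-particle level `ε` of the hopping matrix `A + ε` is
`N`-fold degenerate and the projection `P` onto it is irreducible, then the ground state with
`N` electrons is ferromagnetic and unique up to the spin degeneracy. -/
theorem isUniqueFerromagnet_of_irreducible [DecidableEq Λ] {A B C P : Matrix Λ Λ ℂ} {N : ℕ}
    (hB : A = B.conjTranspose * B) (hPh : P.IsHermitian) (hAP : A * P = 0) (hC : 1 - P = C * A)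
    (ht : P.trace = N)
    (hirr : ∀ S : Set Λ, (∀ x ∈ S, ∀ y ∉ S, P x y = 0) → S = ∅ ∨ S = Set.univ)
    (ε : ℝ) {U : ℝ} (hU : 0 < U) :
    IsUniqueFerromagnet (hubbard (A + (ε : ℂ) • 1) U) N := by
  have hP : P * P = P := by
    have : (1 - P) * P = 0 := by rw [hC, Matrix.mul_assoc, hAP, Matrix.mul_zero]
    rw [Matrix.sub_mul, Matrix.one_mul, sub_eq_zero] at this
    exact this.symm
  obtain ⟨b, lam, hli, hlam⟩ := exists_row_basis P (rank_eq_of_trace hP ht)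
  have hinv : ∀ v, ∀ φ ∈ flatSpace A, annihilateVec v φ ∈ flatSpace A :=
    fun v φ hφ => annihilateVec_mem_flatSpace v hφ
  have hpair : ∀ φ ∈ flatSpace A, ∀ y, annihilate (y, true) (annihilate (y, false) φ) = 0 :=
    fun φ hφ => (mem_flatSpace.1 hφ).2
  have hlam' : ∀ φ ∈ flatSpace A, ∀ y τ,
      annihilate (y, τ) φ = ∑ i, lam y i • annihilate (b i, τ) φ := by
    intro φ hφ y τ
    -- A linear relation among the rows of `P` is a left null vector `w`; then `w = w (1 - P) = (w
    -- C) A` is a combination of rows of `A`, whose annihilators vanish on `flatSpace A`.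
    let w : Λ → ℂ := Pi.single y 1 - ∑ i, lam y i • Pi.single (b i) 1
    have hw : Matrix.vecMul w P = 0 := by
      simp only [w, Matrix.sub_vecMul, Matrix.sum_vecMul, Matrix.smul_vecMul,
        Matrix.single_one_vecMul]
      rw [sub_eq_zero]
      exact hlam y
    have hw2 : w = Matrix.vecMul (Matrix.vecMul w C) A := by
      rw [Matrix.vecMul_vecMul, ← hC, Matrix.vecMul_sub, hw, Matrix.vecMul_one, sub_zero]
    have h0 := annihilateVec_vecMul hφ (Matrix.vecMul w C) τ
    rw [← hw2] at h0
    have hs : ∀ x, annihilateVec (spinVec τ (Pi.single x 1)) φ = annihilate (x, τ) φ := by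
      intro x
      rw [annihilateVec_spinVec, Finset.sum_eq_single x] <;> simp +contextual
    simp only [w, map_sub, map_sum, map_smul, LinearMap.sub_apply, LinearMap.sum_apply,
      LinearMap.smul_apply, hs] at h0
    exact sub_eq_zero.1 h0
  have hconn := row_coefficients_connected hP hPh hirr hli hlam
  have hdim := finrank_le_of_spinAmplitude hinv hlam' hpair hconn
  have hQ : (1 - P).rank = Fintype.card Λ - N := by
    have hPN := rank_eq_of_trace hP ht
    refine rank_eq_of_trace ?_ ?_
    · simp [Matrix.mul_sub, Matrix.sub_mul, hP]
    · have hle : N ≤ Fintype.card Λ := hPN ▸ Matrix.rank_le_card_width P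
      rw [Matrix.trace_sub, Matrix.trace_one, ht, Nat.cast_sub hle]
  obtain ⟨r, mu, -, hmu⟩ := exists_row_basis (1 - P) hQ
  obtain ⟨n, ψ, hψ, hn, hl⟩ := exists_polarized_of_list (List.ofFn fun i => (1 - P) (r i))
  have hψf : ψ ∈ flatSpace A := by
    rw [mem_flatSpace]
    refine ⟨fun x σ => ?_, fun x => by rw [hψ.annihilate_down, map_zero]⟩
    cases σ
    · rw [annihilateVec_spinVec]
      exact Finset.sum_eq_zero fun y _ => by rw [hψ.annihilate_down, smul_zero]
    · have hAx : A x = ∑ y, A x y • (1 - P) y := by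
        have h1 : A = A * (1 - P) := by rw [Matrix.mul_sub, hAP, Matrix.mul_one, sub_zero]
        ext z
        conv_lhs => rw [h1]
        rw [Matrix.mul_apply, Finset.sum_apply]
        rfl
      rw [hAx, map_sum, map_sum, LinearMap.sum_apply]
      refine Finset.sum_eq_zero fun y _ => ?_
      rw [hmu y]
      simp only [map_sum, map_smul, LinearMap.smul_apply, LinearMap.sum_apply]
      rw [Finset.sum_eq_zero, smul_zero]
      intro i _
      rw [hl _ (List.mem_ofFn.2 ⟨i, rfl⟩), smul_zero]
  -- The `card Λ - N` vectors span the rows of `1 - P`; imposing them costs at most that many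
  -- electrons, so `n ≥ N`, while no state of `flatSpace A` has more than `N`.
  have hnN : n = N := by
    have h1 : n ≤ N := by
      by_contra! h
      exact hψ.ne_zero (eq_zero_of_lt_sector hinv hlam' hpair h hψf hψ.mem_sector)
    rw [List.length_ofFn] at hn
    have : N ≤ Fintype.card Λ := rank_eq_of_trace hP ht ▸ Matrix.rank_le_card_width P
    omega
  subst hnN
  have hmult := hψ.multiplet (V := sector Λ n ⊓ flatSpace A) ⟨hψ.mem_sector, hψf⟩
    (fun φ hφ => ⟨spinLower_mem_sector hφ.1, spinLower_mem_flatSpace hφ.2⟩) hdim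
  refine ⟨ε * n, isLeast_energyLevels hB ε hU hψ.ne_zero hψ.mem_sector hψf, ?_⟩
  rw [levelSpace_eq_flatSpace hB ε hU n]
  exact hmult

end Irreducible

/-! ### Translation invariant matrices and their symbols. -/

section FourierMatrix

variable {G ι : Type*} [AddCommGroup G] [Fintype G]

/-- The translation invariant matrix on `G × ι` with the symbol `a`. -/
noncomputable def fourierMatrix (a : AddChar G ℂ → Matrix ι ι ℂ) : Matrix (G × ι) (G × ι) ℂ :=
  fun x y => (Fintype.card G : ℂ)⁻¹ * ∑ χ : AddChar G ℂ, χ (x.1 - y.1) * a χ x.2 y.2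

theorem fourierMatrix_add (a b : AddChar G ℂ → Matrix ι ι ℂ) :
    fourierMatrix (a + b) = fourierMatrix a + fourierMatrix b := by
  ext x y
  simp [fourierMatrix, mul_add, Finset.sum_add_distrib]

theorem fourierMatrix_sub (a b : AddChar G ℂ → Matrix ι ι ℂ) :
    fourierMatrix (a - b) = fourierMatrix a - fourierMatrix b := by
  ext x y
  simp [fourierMatrix, mul_sub, Finset.sum_sub_distrib]

theorem fourierMatrix_smul (c : ℂ) (a : AddChar G ℂ → Matrix ι ι ℂ) :
    fourierMatrix (c • a) = c • fourierMatrix a := by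
  ext x y
  simp only [fourierMatrix, Pi.smul_apply, Matrix.smul_apply, smul_eq_mul, Finset.mul_sum]
  exact Finset.sum_congr rfl fun χ _ => by ring

theorem fourierMatrix_zero : fourierMatrix (0 : AddChar G ℂ → Matrix ι ι ℂ) = 0 := by
  ext x y
  simp [fourierMatrix]

theorem fourierMatrix_one [DecidableEq G] [DecidableEq ι] :
    fourierMatrix (1 : AddChar G ℂ → Matrix ι ι ℂ) = 1 := by
  ext x y
  simp only [fourierMatrix, Pi.one_apply, ← Finset.sum_mul]
  rw [AddChar.sum_apply_eq_ite]
  simp only [Matrix.one_apply, sub_eq_zero, Prod.ext_iff]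
  by_cases h1 : x.1 = y.1 <;> by_cases h2 : x.2 = y.2 <;> simp [h1, h2]

theorem fourierMatrix_conjTranspose (a : AddChar G ℂ → Matrix ι ι ℂ) :
    (fourierMatrix a).conjTranspose = fourierMatrix fun χ => (a χ).conjTranspose := by
  ext x y
  simp only [fourierMatrix, Matrix.conjTranspose_apply, star_mul', star_sum, star_inv₀,
    Complex.star_def, Complex.conj_natCast, ← AddChar.map_neg_eq_conj, neg_sub]

/-- Orthogonality of characters in convolution form: the source of both the product rule for symbols
and the action on Bloch waves. -/
theorem AddChar.sum_conv [DecidableEq (AddChar G ℂ)] (χ χ' : AddChar G ℂ) (R R' : G) :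
    ∑ S, χ (R - S) * χ' (S - R') = if χ = χ' then Fintype.card G * χ (R - R') else 0 := by
  have h : ∀ S, χ (R - S) * χ' (S - R') = (χ R * χ' (-R')) * (χ' - χ) S := by
    intro S
    rw [sub_eq_add_neg R, sub_eq_add_neg S, sub_eq_add_neg χ', AddChar.map_add_eq_mul,
      AddChar.map_add_eq_mul, AddChar.add_apply, AddChar.neg_apply]
    ring
  rw [Finset.sum_congr rfl fun S _ => h S, ← Finset.mul_sum, AddChar.sum_eq_ite]
  by_cases hχ : χ = χ'
  · subst hχ
    rw [if_pos (sub_self χ), if_pos rfl, ← AddChar.map_add_eq_mul, ← sub_eq_add_neg, mul_comm]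
  · rw [if_neg (fun h => hχ (sub_eq_zero.1 h).symm), if_neg hχ, mul_zero]

variable [Fintype ι]

theorem fourierMatrix_mul (a b : AddChar G ℂ → Matrix ι ι ℂ) :
    fourierMatrix a * fourierMatrix b = fourierMatrix (a * b) := by
  classical
  ext x y
  have hN : (Fintype.card G : ℂ) ≠ 0 := Nat.cast_ne_zero.2 Fintype.card_ne_zero
  simp only [Matrix.mul_apply, fourierMatrix, Fintype.sum_prod_type, Pi.mul_apply]
  rw [Finset.sum_comm]
  simp only [Finset.mul_sum, Finset.sum_mul]
  have h : ∀ γ : ι, ∑ S : G, ∑ χ' : AddChar G ℂ, ∑ χ : AddChar G ℂ,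
      (Fintype.card G : ℂ)⁻¹ * (χ (x.1 - S) * a χ x.2 γ) *
        ((Fintype.card G : ℂ)⁻¹ * (χ' (S - y.1) * b χ' γ y.2)) =
      ∑ χ : AddChar G ℂ, (Fintype.card G : ℂ)⁻¹ * (χ (x.1 - y.1) * (a χ x.2 γ * b χ γ y.2)) := by
    intro γ
    rw [Finset.sum_comm]
    refine Finset.sum_congr rfl fun χ' _ => ?_
    rw [Finset.sum_comm]
    have h2 : ∀ χ : AddChar G ℂ, ∑ S : G, (Fintype.card G : ℂ)⁻¹ * (χ (x.1 - S) * a χ x.2 γ) *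
        ((Fintype.card G : ℂ)⁻¹ * (χ' (S - y.1) * b χ' γ y.2)) =
        (Fintype.card G : ℂ)⁻¹ * (Fintype.card G : ℂ)⁻¹ * (a χ x.2 γ * b χ' γ y.2) *
          if χ = χ' then Fintype.card G * χ (x.1 - y.1) else 0 := by
      intro χ
      rw [← AddChar.sum_conv, Finset.mul_sum]
      exact Finset.sum_congr rfl fun S _ => by ring
    simp only [h2, mul_ite, mul_zero, Finset.sum_ite_eq', Finset.mem_univ, if_true]
    field_simp
  refine (Finset.sum_congr rfl fun γ _ => h γ).trans ?_
  rw [Finset.sum_comm]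

theorem trace_fourierMatrix (a : AddChar G ℂ → Matrix ι ι ℂ) :
    (fourierMatrix a).trace = ∑ χ, (a χ).trace := by
  have hN : (Fintype.card G : ℂ) ≠ 0 := Nat.cast_ne_zero.2 Fintype.card_ne_zero
  simp only [Matrix.trace, Matrix.diag, fourierMatrix, Fintype.sum_prod_type, sub_self,
    AddChar.map_zero_eq_one, one_mul, Finset.sum_const, Finset.card_univ, nsmul_eq_mul]
  rw [← Finset.mul_sum, ← mul_assoc, mul_inv_cancel₀ hN, one_mul, Finset.sum_comm]

theorem fourierMatrix_mulVec (a : AddChar G ℂ → Matrix ι ι ℂ) (χ : AddChar G ℂ) (u : ι → ℂ) :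
    (fourierMatrix a).mulVec (fun x => χ x.1 * u x.2) =
      fun x => χ x.1 * (a χ).mulVec u x.2 := by
  classical
  have hN : (Fintype.card G : ℂ) ≠ 0 := Nat.cast_ne_zero.2 Fintype.card_ne_zero
  ext x
  simp only [Matrix.mulVec, dotProduct, fourierMatrix, Fintype.sum_prod_type, Finset.mul_sum,
    Finset.sum_mul]
  rw [Finset.sum_comm]
  refine Finset.sum_congr rfl fun γ _ => ?_
  rw [Finset.sum_comm]
  have h2 : ∀ χ' : AddChar G ℂ, ∑ S : G, (Fintype.card G : ℂ)⁻¹ * (χ' (x.1 - S) * a χ' x.2 γ) *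
      (χ S * u γ) = (Fintype.card G : ℂ)⁻¹ * (a χ' x.2 γ * u γ) *
        if χ' = χ then Fintype.card G * χ' (x.1 - 0) else 0 := by
    intro χ'
    rw [← AddChar.sum_conv, Finset.mul_sum]
    exact Finset.sum_congr rfl fun S _ => by rw [sub_zero]; ring
  simp only [h2, mul_ite, mul_zero, Finset.sum_ite_eq', Finset.mem_univ, if_true, sub_zero]
  field_simp

/-- Every vector in the range of a translation invariant matrix is a sum of Bloch waves. -/
theorem fourierMatrix_mulVec_eq_sum (a : AddChar G ℂ → Matrix ι ι ℂ) (v : G × ι → ℂ) :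
    (fourierMatrix a).mulVec v = ∑ χ : AddChar G ℂ, fun x => χ x.1 * (a χ).mulVec
      (fun γ => (Fintype.card G : ℂ)⁻¹ * ∑ R, χ (-R) * v (R, γ)) x.2 := by
  ext x
  rw [Finset.sum_apply]
  simp only [Matrix.mulVec, dotProduct, fourierMatrix, Fintype.sum_prod_type, Finset.mul_sum,
    Finset.sum_mul]
  rw [Finset.sum_comm]
  have : ∀ χ : AddChar G ℂ, ∀ R, χ (x.1 - R) = χ x.1 * χ (-R) := fun χ R => by
    rw [sub_eq_add_neg, AddChar.map_add_eq_mul]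
  simp only [this]
  rw [Finset.sum_comm' (t' := Finset.univ) (s' := fun _ => Finset.univ) (by simp)]
  refine (Finset.sum_congr rfl fun S _ => Finset.sum_comm).trans ?_
  rw [Finset.sum_comm]
  refine Finset.sum_congr rfl fun χ _ => ?_
  rw [Finset.sum_comm]
  refine Finset.sum_congr rfl fun γ _ => Finset.sum_congr rfl fun R _ => ?_
  ring

end FourierMatrix

/-! ### Spectral projections of a matrix with `h³ = E² h`. -/

section BandProjections

variable {n : Type*} [Fintype n] {h : Matrix n n ℂ} {E : ℝ}

/-- The spectral projection of `h` at the eigenvalue `E`, if the eigenvalues are `0`, `±E`. -/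
noncomputable def bandProj (h : Matrix n n ℂ) (E : ℝ) : Matrix n n ℂ :=
  (2 * (E : ℂ) ^ 2)⁻¹ • (h * h + (E : ℂ) • h)

theorem bandProj_isHermitian (hh : h.IsHermitian) : (bandProj h E).IsHermitian := by
  rw [Matrix.IsHermitian, bandProj, Matrix.conjTranspose_smul, Matrix.conjTranspose_add,
    Matrix.conjTranspose_mul, Matrix.conjTranspose_smul, hh.eq]
  simp

theorem trace_bandProj (hE : E ≠ 0) (h0 : h.trace = 0) (h2 : (h * h).trace = 2 * (E : ℂ) ^ 2) :
    (bandProj h E).trace = 1 := by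
  have hE' : (E : ℂ) ≠ 0 := by exact_mod_cast hE
  rw [bandProj, Matrix.trace_smul, Matrix.trace_add, Matrix.trace_smul, h0, h2, smul_zero, add_zero,
    smul_eq_mul, inv_mul_cancel₀ (by simpa using hE')]

variable [DecidableEq n]

/-- The spectral projection of `h` at the eigenvalue `0`, if the eigenvalues are `0`, `±E`. -/
noncomputable def zeroProj (h : Matrix n n ℂ) (E : ℝ) : Matrix n n ℂ :=
  1 - ((E : ℂ) ^ 2)⁻¹ • (h * h)

theorem zeroProj_isHermitian (hh : h.IsHermitian) : (zeroProj h E).IsHermitian := by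
  rw [Matrix.IsHermitian, zeroProj, Matrix.conjTranspose_sub, Matrix.conjTranspose_smul,
    Matrix.conjTranspose_mul, hh.eq]
  simp

theorem mul_bandProj (hE : E ≠ 0) (h3 : h * (h * h) = ((E : ℂ) ^ 2) • h) :
    h * bandProj h E = (E : ℂ) • bandProj h E := by
  have hE' : (E : ℂ) ≠ 0 := by exact_mod_cast hE
  simp only [bandProj, mul_add, Matrix.mul_smul, h3, smul_add, smul_smul]
  rw [add_comm]
  congr 2 <;> ring

theorem mul_zeroProj (hE : E ≠ 0) (h3 : h * (h * h) = ((E : ℂ) ^ 2) • h) :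
    h * zeroProj h E = 0 := by
  have hE' : (E : ℂ) ≠ 0 := by exact_mod_cast hE
  simp only [zeroProj, mul_sub, mul_one, Matrix.mul_smul, h3, smul_smul]
  rw [inv_mul_cancel₀ (pow_ne_zero 2 hE'), one_smul, sub_self]

/-- The interpolation polynomial evaluated at an eigenvalue `c`: it equals `1` at `E` and `0` at `0`
and `-E`. -/
theorem bandProj_mul {v : Matrix n n ℂ} {c : ℂ} (hv : h * v = c • v) :
    bandProj h E * v = ((2 * (E : ℂ) ^ 2)⁻¹ * (c * (c + E))) • v := by
  simp only [bandProj, Matrix.smul_mul, add_mul, mul_assoc, hv, Matrix.mul_smul, smul_smul,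
    ← add_smul]
  congr 1
  ring

theorem bandProj_mul_bandProj (hE : E ≠ 0) (h3 : h * (h * h) = ((E : ℂ) ^ 2) • h) :
    bandProj h E * bandProj h E = bandProj h E := by
  have hE' : (E : ℂ) ≠ 0 := by exact_mod_cast hE
  rw [bandProj_mul (mul_bandProj hE h3), show (2 * (E : ℂ) ^ 2)⁻¹ * ((E : ℂ) * (E + E)) = 1 by
    field_simp; norm_num, one_smul]

theorem bandProj_neg_mul_bandProj (hE : E ≠ 0) (h3 : h * (h * h) = ((E : ℂ) ^ 2) • h) :
    bandProj h (-E) * bandProj h E = 0 := by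
  rw [bandProj_mul (mul_bandProj hE h3)]
  simp

theorem bandProj_mul_zeroProj (hE : E ≠ 0) (h3 : h * (h * h) = ((E : ℂ) ^ 2) • h) :
    bandProj h E * zeroProj h E = 0 := by
  rw [bandProj_mul (c := 0) (by rw [mul_zeroProj hE h3, zero_smul])]
  simp

theorem bandProj_add_bandProj_neg (hE : E ≠ 0) :
    bandProj h E + bandProj h (-E) + zeroProj h E = 1 := by
  have hE' : (E : ℂ) ≠ 0 := by exact_mod_cast hE
  simp only [bandProj, zeroProj, Complex.ofReal_neg, neg_sq, ← smul_add]
  rw [show h * h + (E : ℂ) • h + (h * h + -(E : ℂ) • h) = (2 : ℂ) • (h * h) by module, smul_smul,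
    show (2 * (E : ℂ) ^ 2)⁻¹ * 2 = ((E : ℂ) ^ 2)⁻¹ by field_simp]
  abel

theorem zeroProj_mul_bandProj (hE : E ≠ 0) (h3 : h * (h * h) = ((E : ℂ) ^ 2) • h) :
    zeroProj h E * bandProj h E = 0 := by
  have hE' : (E : ℂ) ≠ 0 := by exact_mod_cast hE
  rw [zeroProj, sub_mul, one_mul, Matrix.smul_mul, mul_assoc, mul_bandProj hE h3, Matrix.mul_smul,
    mul_bandProj hE h3, smul_smul, smul_smul,
    show ((E : ℂ) ^ 2)⁻¹ * E * E = 1 by field_simp, one_smul, sub_self]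

theorem zeroProj_mul_zeroProj (hE : E ≠ 0) (h3 : h * (h * h) = ((E : ℂ) ^ 2) • h) :
    zeroProj h E * zeroProj h E = zeroProj h E := by
  nth_rewrite 1 [zeroProj]
  rw [sub_mul, one_mul, Matrix.smul_mul, mul_assoc, mul_zeroProj hE h3]
  simp

theorem zeroProj_neg : zeroProj h (-E) = zeroProj h E := by simp [zeroProj]

end BandProjections

/-! ### The Bloch Hamiltonian and its three bands. -/

section KagomeSymbol

variable (Γ : AddSubgroup (ℤ × ℤ))

/-- The Bloch Hamiltonian of the Kagome lattice. -/
noncomputable def kagomeSymbol (s : ℤˣ) (χ : AddChar (Cell Γ) ℂ) : Matrix (Fin 3) (Fin 3) ℂ :=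
  (((s : ℤ) : ℂ) * I / 2) •
    !![0, -(1 + χ (-((1, 0) : ℤ × ℤ))), 1 + χ (-((0, 1) : ℤ × ℤ));
      1 + χ ((1, 0) : ℤ × ℤ), 0, -(1 + χ (((1, 0) : ℤ × ℤ) - ((0, 1) : ℤ × ℤ)));
      -(1 + χ ((0, 1) : ℤ × ℤ)), 1 + χ (((0, 1) : ℤ × ℤ) - ((1, 0) : ℤ × ℤ)), 0]

theorem kagomeSymbol_trace (s : ℤˣ) (χ : AddChar (Cell Γ) ℂ) :
    (kagomeSymbol Γ s χ).trace = 0 := by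
  simp [kagomeSymbol, Matrix.trace, Fin.sum_univ_three]

open scoped Classical in
-- Each off-diagonal entry of the symbol stands for two bonds, one in an up and one in a down
-- triangle; inverting the Fourier sum recovers both.
theorem sum_character_edge {G : Type*} [AddCommGroup G] [Fintype G] (c : ℂ) (D a : G) :
    (Fintype.card G : ℂ)⁻¹ * ∑ χ : AddChar G ℂ, χ D * (c * (1 + χ a)) =
      (if D = 0 then c else 0) + if D + a = 0 then c else 0 := by
  have hN : (Fintype.card G : ℂ) ≠ 0 := Nat.cast_ne_zero.2 Fintype.card_ne_zero
  have h : ∀ χ : AddChar G ℂ, χ D * (c * (1 + χ a)) = c * χ D + c * χ (D + a) := by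
    intro χ
    rw [AddChar.map_add_eq_mul]
    ring
  simp only [h, Finset.sum_add_distrib, ← Finset.mul_sum, AddChar.sum_apply_eq_ite]
  split_ifs <;> field_simp <;> ring

open scoped Classical in
theorem sum_character_edge_neg {G : Type*} [AddCommGroup G] [Fintype G] (c : ℂ) (D a : G) :
    (Fintype.card G : ℂ)⁻¹ * ∑ χ : AddChar G ℂ, χ D * (c * (-χ a + -1)) =
      (if D = 0 then -c else 0) + if D + a = 0 then -c else 0 := by
  rw [← sum_character_edge]
  congr 1
  exact Finset.sum_congr rfl fun χ _ => by ring

theorem sum_edge {G : Type*} [AddCommGroup G] [Fintype G] [DecidableEq G] (c : ℂ)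
    (p q X Y : G) :
    ∑ R, (if R - p = X ∧ R - q = Y then c else 0) = if X - Y + (p - q) = 0 then c else 0 := by
  have h : ∀ R, (R - p = X ∧ R - q = Y) ↔ (R = X + p ∧ X - Y + (p - q) = 0) := by
    intro R
    constructor
    · rintro ⟨rfl, rfl⟩
      exact ⟨by abel, by abel⟩
    · rintro ⟨rfl, h⟩
      refine ⟨by abel, ?_⟩
      rw [← sub_eq_zero, ← h]
      abel
  simp only [h, ite_and, Finset.sum_ite_eq', Finset.mem_univ, if_true]

variable [Γ.FiniteIndex]

theorem kagomeHopping_eq (s : ℤˣ) :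
    kagomeHopping Γ s = fourierMatrix (kagomeSymbol Γ s) := by
  classical
  ext ⟨X, α⟩ ⟨Y, β⟩
  have e0 := fun c : ℂ => sum_edge c 0 0 X Y
  have e1 := fun (c : ℂ) a => sum_edge c a 0 X Y
  have e2 := fun (c : ℂ) a => sum_edge c 0 a X Y
  simp only [sub_zero, sub_self, zero_sub, add_zero] at e0 e1 e2
  simp only [kagomeHopping, fourierMatrix, Fin.sum_univ_six, arrow, kagomeSymbol,
    Matrix.smul_apply, smul_eq_mul, Prod.mk.injEq, Finset.sum_add_distrib]
  fin_cases α <;> fin_cases β <;>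
    simp [sum_character_edge, sum_character_edge_neg, -mul_neg, -neg_mul, e0, e1, e2, sum_edge] <;>
    congr!

theorem kagomeSymbol_isHermitian (s : ℤˣ) (χ : AddChar (Cell Γ) ℂ) :
    (kagomeSymbol Γ s χ).IsHermitian := by
  have h : ∀ a, (starRingEnd ℂ) (χ a) = χ (-a) := fun a => (AddChar.map_neg_eq_conj χ a).symm
  ext i j
  fin_cases i <;> fin_cases j <;>
    simp [kagomeSymbol, Matrix.conjTranspose_apply, h, neg_div] <;> ring

/-- The energy of the highest band. -/
noncomputable def kagomeEnergy (χ : AddChar (Cell Γ) ℂ) : ℝ :=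
  Real.sqrt ((3 + (χ ((1, 0) : ℤ × ℤ)).re + (χ ((0, 1) : ℤ × ℤ)).re +
    (χ (((1, 0) : ℤ × ℤ) - ((0, 1) : ℤ × ℤ))).re) / 2)

theorem kagomeEnergy_radicand_pos (χ : AddChar (Cell Γ) ℂ) :
    0 < (3 + (χ ((1, 0) : ℤ × ℤ)).re + (χ ((0, 1) : ℤ × ℤ)).re +
      (χ (((1, 0) : ℤ × ℤ) - ((0, 1) : ℤ × ℤ))).re) / 2 := by
  have h1 := AddChar.norm_apply χ (((1, 0) : ℤ × ℤ) : Cell Γ)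
  have h2 := AddChar.norm_apply χ (((0, 1) : ℤ × ℤ) : Cell Γ)
  rw [sub_eq_add_neg, AddChar.map_add_eq_mul, AddChar.map_neg_eq_conj]
  set u := χ (((1, 0) : ℤ × ℤ) : Cell Γ)
  set v := χ (((0, 1) : ℤ × ℤ) : Cell Γ)
  have k1 : u.re * u.re + u.im * u.im = 1 := by
    rw [← Complex.normSq_apply, Complex.normSq_eq_norm_sq, h1, one_pow]
  have k2 : v.re * v.re + v.im * v.im = 1 := by
    rw [← Complex.normSq_apply, Complex.normSq_eq_norm_sq, h2, one_pow]
  simp only [Complex.mul_re, Complex.conj_re, Complex.conj_im]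
  -- The radicand equals `(3 + |1 + u + v|²) / 4`, so the bands never touch.
  nlinarith [sq_nonneg (1 + u.re + v.re), sq_nonneg (u.im + v.im)]

theorem kagomeEnergy_pos (χ : AddChar (Cell Γ) ℂ) : 0 < kagomeEnergy Γ χ :=
  Real.sqrt_pos.2 (kagomeEnergy_radicand_pos Γ χ)

theorem kagomeEnergy_neg (χ : AddChar (Cell Γ) ℂ) : kagomeEnergy Γ (-χ) = kagomeEnergy Γ χ := by
  simp only [kagomeEnergy, AddChar.neg_apply, AddChar.map_neg_eq_conj, Complex.conj_re]

theorem kagomeEnergy_sq (χ : AddChar (Cell Γ) ℂ) : (kagomeEnergy Γ χ : ℂ) ^ 2 =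
    (6 + χ ((1, 0) : ℤ × ℤ) + χ (-((1, 0) : ℤ × ℤ)) + χ ((0, 1) : ℤ × ℤ) +
      χ (-((0, 1) : ℤ × ℤ)) + χ ((1, 0) : ℤ × ℤ) * χ (-((0, 1) : ℤ × ℤ)) +
        χ ((0, 1) : ℤ × ℤ) * χ (-((1, 0) : ℤ × ℤ))) / 4 := by
  rw [← Complex.ofReal_pow, kagomeEnergy, Real.sq_sqrt (kagomeEnergy_radicand_pos Γ χ).le]
  rw [sub_eq_add_neg, AddChar.map_add_eq_mul]
  simp only [AddChar.map_neg_eq_conj]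
  push_cast
  simp only [Complex.re_eq_add_conj, map_mul, Complex.conj_conj]
  ring

theorem intUnit_cast_sq (s : ℤˣ) : ((s : ℤ) : ℂ) ^ 2 = 1 := by
  rcases Int.units_eq_one_or s with rfl | rfl <;> simp

/-- This is Cayley–Hamilton: the trace is zero, and so is the determinant, because `(1 + ū)(1 + u
v̄)(1 + v)` is real for phases `u`, `v` while the cube of the prefactor is imaginary. -/
theorem kagomeSymbol_cube (s : ℤˣ) (χ : AddChar (Cell Γ) ℂ) :
    kagomeSymbol Γ s χ * (kagomeSymbol Γ s χ * kagomeSymbol Γ s χ) =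
      ((kagomeEnergy Γ χ : ℂ) ^ 2) • kagomeSymbol Γ s χ := by
  have k1 : χ ((1, 0) : ℤ × ℤ) * χ (-((1, 0) : ℤ × ℤ)) = 1 := by
    rw [← AddChar.map_add_eq_mul, add_neg_cancel, AddChar.map_zero_eq_one]
  have k2 : χ ((0, 1) : ℤ × ℤ) * χ (-((0, 1) : ℤ × ℤ)) = 1 := by
    rw [← AddChar.map_add_eq_mul, add_neg_cancel, AddChar.map_zero_eq_one]
  have hc : (((s : ℤ) : ℂ) * I / 2) ^ 2 = -1 / 4 := by
    rw [div_pow, mul_pow, intUnit_cast_sq, I_sq]; norm_num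
  rw [kagomeEnergy_sq]
  simp only [kagomeSymbol, sub_eq_add_neg, AddChar.map_add_eq_mul]
  set c := ((s : ℤ) : ℂ) * I / 2
  generalize χ ((1, 0) : ℤ × ℤ) = u at *
  generalize χ ((0, 1) : ℤ × ℤ) = v at *
  generalize χ (-((1, 0) : ℤ × ℤ)) = u' at *
  generalize χ (-((0, 1) : ℤ × ℤ)) = v' at *
  have hu : u ≠ 0 := left_ne_zero_of_mul_eq_one k1
  have hv : v ≠ 0 := left_ne_zero_of_mul_eq_one k2
  have hu' : u' = u⁻¹ := eq_inv_of_mul_eq_one_right k1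
  have hv' : v' = v⁻¹ := eq_inv_of_mul_eq_one_right k2
  subst hu' hv'
  simp only [Matrix.smul_mul, Matrix.mul_smul, smul_smul]
  rw [show c * c * c = -1 / 4 * c by linear_combination c * hc]
  ext i j
  fin_cases i <;> fin_cases j <;>
    simp <;> first | (field_simp; ring1) | (right; field_simp; ring1)

theorem kagomeSymbol_sq_trace (s : ℤˣ) (χ : AddChar (Cell Γ) ℂ) :
    (kagomeSymbol Γ s χ * kagomeSymbol Γ s χ).trace = 2 * (kagomeEnergy Γ χ : ℂ) ^ 2 := by
  have k1 : χ ((1, 0) : ℤ × ℤ) * χ (-((1, 0) : ℤ × ℤ)) = 1 := by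
    rw [← AddChar.map_add_eq_mul, add_neg_cancel, AddChar.map_zero_eq_one]
  have k2 : χ ((0, 1) : ℤ × ℤ) * χ (-((0, 1) : ℤ × ℤ)) = 1 := by
    rw [← AddChar.map_add_eq_mul, add_neg_cancel, AddChar.map_zero_eq_one]
  have hc : (((s : ℤ) : ℂ) * I / 2) * (((s : ℤ) : ℂ) * I / 2) = -1 / 4 := by
    rw [← pow_two, div_pow, mul_pow, intUnit_cast_sq, I_sq]; norm_num
  rw [kagomeEnergy_sq]
  simp only [kagomeSymbol, sub_eq_add_neg, AddChar.map_add_eq_mul]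
  set c := ((s : ℤ) : ℂ) * I / 2
  generalize χ ((1, 0) : ℤ × ℤ) = u at *
  generalize χ ((0, 1) : ℤ × ℤ) = v at *
  generalize χ (-((1, 0) : ℤ × ℤ)) = u' at *
  generalize χ (-((0, 1) : ℤ × ℤ)) = v' at *
  simp only [Matrix.smul_mul, Matrix.mul_smul, smul_smul, hc]
  simp only [Matrix.trace, Matrix.diag, Fin.sum_univ_three]
  simp
  linear_combination (1 / 2 + 1 / 2 * (v * v')) * k1 + k2

end KagomeSymbol

/-! ### The lowest band, its projection and the flattened hopping. -/

section KagomeBands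

variable (Γ : AddSubgroup (ℤ × ℤ))

theorem bloch_injective (χ : AddChar (Cell Γ) ℂ) {u v : Fin 3 → ℂ}
    (h : (WithLp.toLp 2 fun x : Site Γ => χ x.1 * u x.2 : EuclideanSpace ℂ (Site Γ)) =
      WithLp.toLp 2 fun x => χ x.1 * v x.2) : u = v := by
  ext α
  have := congrArg (fun f : EuclideanSpace ℂ (Site Γ) => f (0, α)) h
  simpa using this

theorem isBloch_iff {χ : AddChar (Cell Γ) ℂ} {ψ : EuclideanSpace ℂ (Site Γ)} :
    IsBloch Γ χ ψ ↔ ∃ u : Fin 3 → ℂ, ψ = WithLp.toLp 2 fun x => χ x.1 * u x.2 := by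
  constructor
  · intro h
    refine ⟨fun α => ψ (0, α), ?_⟩
    ext ⟨R, α⟩
    have := h R 0 α
    rw [zero_add] at this
    exact this
  · rintro ⟨u, rfl⟩ a R α
    change χ (R + a) * u α = χ a * (χ R * u α)
    rw [AddChar.map_add_eq_mul]
    ring

variable [Γ.FiniteIndex]

/-- The projection onto the lowest band at a crystal momentum. -/
noncomputable def lowSymbol (s : ℤˣ) (χ : AddChar (Cell Γ) ℂ) : Matrix (Fin 3) (Fin 3) ℂ :=
  bandProj (kagomeSymbol Γ s χ) (-kagomeEnergy Γ χ)

theorem kagomeEnergy_ne_zero (χ : AddChar (Cell Γ) ℂ) : kagomeEnergy Γ χ ≠ 0 :=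
  (kagomeEnergy_pos Γ χ).ne'

theorem neg_kagomeEnergy_ne_zero (χ : AddChar (Cell Γ) ℂ) : -kagomeEnergy Γ χ ≠ 0 :=
  neg_ne_zero.2 (kagomeEnergy_ne_zero Γ χ)

theorem kagomeSymbol_cube' (s : ℤˣ) (χ : AddChar (Cell Γ) ℂ) :
    kagomeSymbol Γ s χ * (kagomeSymbol Γ s χ * kagomeSymbol Γ s χ) =
      (((-kagomeEnergy Γ χ : ℝ) : ℂ) ^ 2) • kagomeSymbol Γ s χ := by
  rw [kagomeSymbol_cube, Complex.ofReal_neg, neg_sq]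

theorem lowSymbol_mul_self (s : ℤˣ) (χ : AddChar (Cell Γ) ℂ) :
    lowSymbol Γ s χ * lowSymbol Γ s χ = lowSymbol Γ s χ :=
  bandProj_mul_bandProj (neg_kagomeEnergy_ne_zero Γ χ) (kagomeSymbol_cube' Γ s χ)

theorem lowSymbol_isHermitian (s : ℤˣ) (χ : AddChar (Cell Γ) ℂ) :
    (lowSymbol Γ s χ).IsHermitian :=
  bandProj_isHermitian (kagomeSymbol_isHermitian Γ s χ)

theorem lowSymbol_trace (s : ℤˣ) (χ : AddChar (Cell Γ) ℂ) : (lowSymbol Γ s χ).trace = 1 :=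
  trace_bandProj (neg_kagomeEnergy_ne_zero Γ χ) (kagomeSymbol_trace Γ s χ)
    (by rw [kagomeSymbol_sq_trace, Complex.ofReal_neg, neg_sq])

theorem kagomeSymbol_mul_lowSymbol (s : ℤˣ) (χ : AddChar (Cell Γ) ℂ) :
    kagomeSymbol Γ s χ * lowSymbol Γ s χ = (-kagomeEnergy Γ χ : ℂ) • lowSymbol Γ s χ := by
  have := mul_bandProj (neg_kagomeEnergy_ne_zero Γ χ) (kagomeSymbol_cube' Γ s χ)
  rwa [Complex.ofReal_neg] at this

theorem kagomeOp_bloch (s : ℤˣ) (χ : AddChar (Cell Γ) ℂ) (u : Fin 3 → ℂ) :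
    kagomeOp Γ s (WithLp.toLp 2 fun x => χ x.1 * u x.2) =
      WithLp.toLp 2 fun x => χ x.1 * (kagomeSymbol Γ s χ).mulVec u x.2 := by
  classical
  rw [kagomeOp, Matrix.toLpLin_apply, kagomeHopping_eq, fourierMatrix_mulVec]

theorem kagomeOp_bloch_eq_iff (s : ℤˣ) (χ : AddChar (Cell Γ) ℂ) (u : Fin 3 → ℂ) (E : ℂ) :
    kagomeOp Γ s (WithLp.toLp 2 fun x => χ x.1 * u x.2) =
      E • (WithLp.toLp 2 fun x => χ x.1 * u x.2) ↔ (kagomeSymbol Γ s χ).mulVec u = E • u := by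
  have h : E • (WithLp.toLp 2 fun x : Site Γ => χ x.1 * u x.2 : EuclideanSpace ℂ (Site Γ)) =
      WithLp.toLp 2 fun x => χ x.1 * (E • u) x.2 := by
    ext x
    simp only [PiLp.smul_apply, smul_eq_mul, Pi.smul_apply]
    ring
  rw [kagomeOp_bloch, h]
  exact ⟨bloch_injective Γ χ, fun h => by rw [h]⟩

theorem bandEnergies_isLeast (s : ℤˣ) (χ : AddChar (Cell Γ) ℂ) :
    IsLeast (bandEnergies Γ s χ) (-kagomeEnergy Γ χ) := by
  constructor
  · have hne : lowSymbol Γ s χ ≠ 0 := by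
      intro h
      have := lowSymbol_trace Γ s χ
      rw [h] at this
      simp at this
    obtain ⟨j, hj⟩ : ∃ j, (lowSymbol Γ s χ).mulVec (Pi.single j 1) ≠ 0 := by
      by_contra! h
      refine hne ?_
      ext i j
      simpa using congrFun (h j) i
    refine ⟨WithLp.toLp 2 fun x => χ x.1 * (lowSymbol Γ s χ).mulVec (Pi.single j 1) x.2,
      (isBloch_iff Γ).2 ⟨_, rfl⟩, ?_, ?_⟩
    · intro h
      refine hj (bloch_injective Γ χ (h.trans ?_))
      ext x
      simp
    · rw [kagomeOp_bloch_eq_iff, Matrix.mulVec_mulVec, kagomeSymbol_mul_lowSymbol,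
        Matrix.smul_mulVec, Complex.ofReal_neg]
  · rintro E ⟨φ, hφ, hφ0, hE⟩
    obtain ⟨u, rfl⟩ := (isBloch_iff Γ).1 hφ
    rw [kagomeOp_bloch_eq_iff] at hE
    have hu : u ≠ 0 := by
      rintro rfl
      refine hφ0 ?_
      ext x
      simp
    have h3 := congrArg (fun M : Matrix (Fin 3) (Fin 3) ℂ => M.mulVec u)
      (kagomeSymbol_cube Γ s χ)
    simp only [← Matrix.mulVec_mulVec, Matrix.smul_mulVec, hE, Matrix.mulVec_smul,
      smul_smul] at h3
    have h4 := smul_left_injective ℂ hu h3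
    -- The cubic relation leaves only `0` and `± kagomeEnergy` as band energies.
    have h5 : E * E * E = kagomeEnergy Γ χ ^ 2 * E := by exact_mod_cast h4
    have hp := kagomeEnergy_pos Γ χ
    by_contra! hlt
    have hE0 : E < 0 := by linarith
    have h6 : E * E = kagomeEnergy Γ χ ^ 2 :=
      mul_right_cancel₀ hE0.ne (by linear_combination h5)
    nlinarith

theorem lowSymbol_mulVec {s : ℤˣ} {χ : AddChar (Cell Γ) ℂ} {u : Fin 3 → ℂ}
    (h : (kagomeSymbol Γ s χ).mulVec u = (-kagomeEnergy Γ χ : ℂ) • u) :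
    (lowSymbol Γ s χ).mulVec u = u := by
  have hE : (kagomeEnergy Γ χ : ℂ) ≠ 0 := by exact_mod_cast kagomeEnergy_ne_zero Γ χ
  rw [lowSymbol, bandProj, Matrix.smul_mulVec, Matrix.add_mulVec, Matrix.smul_mulVec,
    ← Matrix.mulVec_mulVec, h, Matrix.mulVec_smul, h, Complex.ofReal_neg, smul_smul, ← add_smul,
    smul_smul]
  convert one_smul ℂ u
  field_simp
  norm_num

/-- The projection onto the lowest band. -/
noncomputable def lowMatrix (s : ℤˣ) : Matrix (Site Γ) (Site Γ) ℂ := fourierMatrix (lowSymbol Γ s)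

theorem lowMatrix_mul_self (s : ℤˣ) : lowMatrix Γ s * lowMatrix Γ s = lowMatrix Γ s := by
  rw [lowMatrix, fourierMatrix_mul]
  congr 1
  ext1 χ
  exact lowSymbol_mul_self Γ s χ

theorem lowMatrix_isHermitian (s : ℤˣ) : (lowMatrix Γ s).IsHermitian := by
  rw [Matrix.IsHermitian, lowMatrix, fourierMatrix_conjTranspose]
  congr 1
  ext1 χ
  exact lowSymbol_isHermitian Γ s χ

theorem lowMatrix_trace (s : ℤˣ) : (lowMatrix Γ s).trace = Fintype.card (Cell Γ) := by
  rw [lowMatrix, trace_fourierMatrix]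
  simp only [lowSymbol_trace, Finset.sum_const, nsmul_eq_mul, mul_one, Finset.card_univ,
    AddChar.card_eq]

open scoped Classical in
theorem lowMatrix_mem_lowestBand (s : ℤˣ) (v : EuclideanSpace ℂ (Site Γ)) :
    Matrix.toEuclideanLin (lowMatrix Γ s) v ∈ lowestBand Γ s := by
  rw [Matrix.toLpLin_apply, lowMatrix, fourierMatrix_mulVec_eq_sum, WithLp.toLp_sum]
  refine Submodule.sum_mem _ fun χ _ => Submodule.subset_span
    ⟨χ, -kagomeEnergy Γ χ, bandEnergies_isLeast Γ s χ, (isBloch_iff Γ).2 ⟨_, rfl⟩, ?_⟩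
  rw [kagomeOp_bloch_eq_iff, Matrix.mulVec_mulVec, kagomeSymbol_mul_lowSymbol,
    Matrix.smul_mulVec, Complex.ofReal_neg]

open scoped Classical in
theorem lowMatrix_apply_of_mem (s : ℤˣ) {v : EuclideanSpace ℂ (Site Γ)}
    (hv : v ∈ lowestBand Γ s) : Matrix.toEuclideanLin (lowMatrix Γ s) v = v := by
  have hle : lowestBand Γ s ≤
      LinearMap.ker (Matrix.toEuclideanLin (lowMatrix Γ s) - LinearMap.id) := by
    refine Submodule.span_le.2 ?_
    rintro ψ ⟨χ, E, hE, hb, hψ⟩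
    obtain ⟨u, rfl⟩ := (isBloch_iff Γ).1 hb
    rw [hE.unique (bandEnergies_isLeast Γ s χ), kagomeOp_bloch_eq_iff, Complex.ofReal_neg] at hψ
    rw [SetLike.mem_coe, LinearMap.mem_ker, LinearMap.sub_apply, sub_eq_zero,
      Matrix.toLpLin_apply, lowMatrix, fourierMatrix_mulVec, lowSymbol_mulVec Γ hψ]
    rfl
  exact sub_eq_zero.1 (hle hv)

open scoped Classical in
theorem starProjection_lowestBand (s : ℤˣ) (v : EuclideanSpace ℂ (Site Γ)) :
    (lowestBand Γ s).starProjection v = Matrix.toEuclideanLin (lowMatrix Γ s) v := by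
  refine Submodule.eq_starProjection_of_mem_of_inner_eq_zero
    (lowMatrix_mem_lowestBand Γ s v) fun w hw => ?_
  have h1 : LinearMap.adjoint (Matrix.toEuclideanLin (lowMatrix Γ s)) =
      Matrix.toEuclideanLin (lowMatrix Γ s) := by
    rw [← Matrix.toEuclideanLin_conjTranspose_eq_adjoint, (lowMatrix_isHermitian Γ s).eq]
  have h2 : Matrix.toEuclideanLin (lowMatrix Γ s) (Matrix.toEuclideanLin (lowMatrix Γ s) v) =
      Matrix.toEuclideanLin (lowMatrix Γ s) v := by
    simp only [Matrix.toLpLin_apply, Matrix.mulVec_mulVec, lowMatrix_mul_self]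
  rw [← lowMatrix_apply_of_mem Γ s hw, ← LinearMap.adjoint_inner_left, h1, map_sub, h2, sub_self,
    inner_zero_left]

open scoped Classical in
theorem flattenedHopping_eq (s : ℤˣ) (ε : ℝ) : flattenedHopping Γ s ε =
    (ε : ℂ) • lowMatrix Γ s + kagomeHopping Γ s * (1 - lowMatrix Γ s) := by
  have h : flattenedOp Γ s ε = Matrix.toEuclideanLin
      ((ε : ℂ) • lowMatrix Γ s + kagomeHopping Γ s * (1 - lowMatrix Γ s)) := by
    ext1 v
    have hk : kagomeOp Γ s (v - Matrix.toEuclideanLin (lowMatrix Γ s) v) =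
        Matrix.toEuclideanLin (kagomeHopping Γ s * (1 - lowMatrix Γ s)) v := by
      simp only [kagomeOp, Matrix.toLpLin_apply, ← Matrix.mulVec_mulVec, Matrix.sub_mulVec,
        Matrix.one_mulVec]
      rfl
    rw [map_add, map_smul, LinearMap.add_apply, LinearMap.smul_apply, ← hk,
      ← starProjection_lowestBand]
    rfl
  ext x y
  rw [flattenedHopping, h, Matrix.toLpLin_apply]
  simp [EuclideanSpace.single]

/-- The Bloch matrix with the eigenvalue `0` on the lowest band and `f E` on an upper band of
energy `E`. -/
noncomputable def upperSymbol (s : ℤˣ) (f : ℝ → ℝ) (χ : AddChar (Cell Γ) ℂ) :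
    Matrix (Fin 3) (Fin 3) ℂ :=
  (f (kagomeEnergy Γ χ) : ℂ) • bandProj (kagomeSymbol Γ s χ) (kagomeEnergy Γ χ) +
    (f 0 : ℂ) • zeroProj (kagomeSymbol Γ s χ) (kagomeEnergy Γ χ)

theorem upperSymbol_isHermitian (s : ℤˣ) (f : ℝ → ℝ) (χ : AddChar (Cell Γ) ℂ) :
    (upperSymbol Γ s f χ).conjTranspose = upperSymbol Γ s f χ := by
  have h := kagomeSymbol_isHermitian Γ s χ
  rw [upperSymbol, Matrix.conjTranspose_add, Matrix.conjTranspose_smul, Matrix.conjTranspose_smul,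
    (bandProj_isHermitian h).eq, (zeroProj_isHermitian h).eq]
  simp

theorem upperSymbol_mul (s : ℤˣ) (f g : ℝ → ℝ) (χ : AddChar (Cell Γ) ℂ) :
    upperSymbol Γ s f χ * upperSymbol Γ s g χ = upperSymbol Γ s (f * g) χ := by
  have hE := kagomeEnergy_ne_zero Γ χ
  have h3 := kagomeSymbol_cube Γ s χ
  simp only [upperSymbol, add_mul, mul_add, Matrix.smul_mul, Matrix.mul_smul, smul_smul,
    bandProj_mul_bandProj hE h3, bandProj_mul_zeroProj hE h3, zeroProj_mul_bandProj hE h3,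
    zeroProj_mul_zeroProj hE h3, smul_zero, add_zero, zero_add, Pi.mul_apply, Complex.ofReal_mul]
  simp only [mul_comm]

theorem upperSymbol_mul_lowSymbol (s : ℤˣ) (f : ℝ → ℝ) (χ : AddChar (Cell Γ) ℂ) :
    upperSymbol Γ s f χ * lowSymbol Γ s χ = 0 := by
  have hE := neg_kagomeEnergy_ne_zero Γ χ
  have h3 := kagomeSymbol_cube' Γ s χ
  have h1 := bandProj_neg_mul_bandProj hE h3
  have h2 := zeroProj_mul_bandProj hE h3
  rw [neg_neg] at h1
  rw [zeroProj_neg] at h2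
  rw [upperSymbol, lowSymbol, add_mul, Matrix.smul_mul, Matrix.smul_mul, h1, h2]
  simp

theorem upperSymbol_one_add_lowSymbol (s : ℤˣ) (χ : AddChar (Cell Γ) ℂ) :
    upperSymbol Γ s 1 χ + lowSymbol Γ s χ = 1 := by
  rw [← bandProj_add_bandProj_neg (h := kagomeSymbol Γ s χ) (kagomeEnergy_ne_zero Γ χ),
    upperSymbol, lowSymbol]
  simp only [Pi.one_apply, Complex.ofReal_one, one_smul]
  abel

theorem kagomeSymbol_mul_upper (s : ℤˣ) (χ : AddChar (Cell Γ) ℂ) :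
    kagomeSymbol Γ s χ * upperSymbol Γ s 1 χ = upperSymbol Γ s id χ := by
  have hE := kagomeEnergy_ne_zero Γ χ
  have h3 := kagomeSymbol_cube Γ s χ
  simp [upperSymbol, mul_add, mul_bandProj hE h3, mul_zeroProj hE h3]

/-- The matrix with the symbol `upperSymbol`. -/
noncomputable def upperMatrix (s : ℤˣ) (f : ℝ → ℝ) : Matrix (Site Γ) (Site Γ) ℂ :=
  fourierMatrix (upperSymbol Γ s f)

theorem upperMatrix_mul (s : ℤˣ) (f g : ℝ → ℝ) :
    upperMatrix Γ s f * upperMatrix Γ s g = upperMatrix Γ s (f * g) := by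
  rw [upperMatrix, upperMatrix, fourierMatrix_mul]
  congr 1
  ext1 χ
  exact upperSymbol_mul Γ s f g χ

theorem upperMatrix_conjTranspose (s : ℤˣ) (f : ℝ → ℝ) :
    (upperMatrix Γ s f).conjTranspose = upperMatrix Γ s f := by
  rw [upperMatrix, fourierMatrix_conjTranspose]
  congr 1
  ext1 χ
  exact upperSymbol_isHermitian Γ s f χ

theorem upperMatrix_mul_lowMatrix (s : ℤˣ) (f : ℝ → ℝ) :
    upperMatrix Γ s f * lowMatrix Γ s = 0 := by
  rw [upperMatrix, lowMatrix, fourierMatrix_mul, ← fourierMatrix_zero]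
  congr 1
  ext1 χ
  exact upperSymbol_mul_lowSymbol Γ s f χ

open scoped Classical in
theorem one_sub_lowMatrix (s : ℤˣ) : 1 - lowMatrix Γ s = upperMatrix Γ s 1 := by
  rw [sub_eq_iff_eq_add, upperMatrix, lowMatrix, ← fourierMatrix_add, ← fourierMatrix_one]
  congr 1
  ext1 χ
  exact (upperSymbol_one_add_lowSymbol Γ s χ).symm

/-- The two upper bands have nonnegative energies, so the behaviour of a square root or an inverse
elsewhere is irrelevant. -/
theorem upperMatrix_congr (s : ℤˣ) {f g : ℝ → ℝ} (h : ∀ E, 0 ≤ E → f E = g E) :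
    upperMatrix Γ s f = upperMatrix Γ s g := by
  rw [upperMatrix, upperMatrix]
  congr 1
  ext1 χ
  rw [upperSymbol, upperSymbol, h _ (kagomeEnergy_pos Γ χ).le, h 0 le_rfl]

open scoped Classical in
theorem flattenedHopping_eq_upperMatrix (s : ℤˣ) (ε : ℝ) : flattenedHopping Γ s ε =
    upperMatrix Γ s (fun E => E - ε) + (ε : ℂ) • 1 := by
  have h1 : upperMatrix Γ s (fun E => E - ε) =
      upperMatrix Γ s id - (ε : ℂ) • upperMatrix Γ s 1 := by
    rw [upperMatrix, upperMatrix, upperMatrix, ← fourierMatrix_smul, ← fourierMatrix_sub]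
    congr 1
    ext1 χ
    simp only [upperSymbol, Pi.sub_apply, Pi.smul_apply, Pi.one_apply, id_eq, Complex.ofReal_sub,
      Complex.ofReal_one, Complex.ofReal_zero]
    module
  have h2 : kagomeHopping Γ s * upperMatrix Γ s 1 = upperMatrix Γ s id := by
    rw [kagomeHopping_eq, upperMatrix, upperMatrix, fourierMatrix_mul]
    congr 1
    ext1 χ
    exact kagomeSymbol_mul_upper Γ s χ
  rw [flattenedHopping_eq, one_sub_lowMatrix, h2, h1, ← one_sub_lowMatrix]
  module

end KagomeBands

/-! ### Irreducibility of the lowest-band projection. -/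

section KagomeFerromagnet

variable (Γ : AddSubgroup (ℤ × ℤ))

theorem eq_univ_of_add_mem {T : Set (Cell Γ)} {R₀ : Cell Γ} (h0 : R₀ ∈ T)
    (h1 : ∀ R, R ∈ T ↔ R + ((1, 0) : ℤ × ℤ) ∈ T) (h2 : ∀ R, R ∈ T ↔ R + ((0, 1) : ℤ × ℤ) ∈ T)
    (R : Cell Γ) : R ∈ T := by
  have k : ∀ (a : Cell Γ), (∀ R, R ∈ T ↔ R + a ∈ T) → ∀ (n : ℤ) R, R ∈ T → R + n • a ∈ T := by
    intro a ha n
    induction n using Int.induction_on with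
    | zero => intro R hR; simpa using hR
    | succ n ih =>
      intro R hR
      rw [add_zsmul, one_zsmul, ← add_assoc]
      exact (ha _).1 (ih R hR)
    | pred n ih =>
      intro R hR
      rw [ha, sub_zsmul, one_zsmul, add_assoc, neg_add_cancel_right]
      exact ih R hR
  obtain ⟨⟨m, n⟩, hmn⟩ := QuotientAddGroup.mk_surjective (R - R₀)
  have : R = R₀ + m • (((1, 0) : ℤ × ℤ) : Cell Γ) + n • (((0, 1) : ℤ × ℤ) : Cell Γ) := by
    rw [add_assoc, ← QuotientAddGroup.mk_zsmul, ← QuotientAddGroup.mk_zsmul,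
      ← QuotientAddGroup.mk_add, ← sub_eq_iff_eq_add', ← hmn]
    simp
  rw [this]
  exact k _ h2 n _ (k _ h1 m _ h0)

variable [Γ.FiniteIndex]

/-- The hopping is `i` times a real matrix, so conjugation reverses both its sign and the momentum.
-/
theorem kagomeSymbol_neg (s : ℤˣ) (χ : AddChar (Cell Γ) ℂ) (i j : Fin 3) :
    kagomeSymbol Γ s (-χ) i j = -(starRingEnd ℂ) (kagomeSymbol Γ s χ i j) := by
  have h : ∀ a, (starRingEnd ℂ) (χ a) = χ (-a) := fun a => (AddChar.map_neg_eq_conj χ a).symm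
  fin_cases i <;> fin_cases j <;> simp [kagomeSymbol, AddChar.neg_apply, h, neg_div, map_ofNat]

theorem kagomeSymbol_sq_neg (s : ℤˣ) (χ : AddChar (Cell Γ) ℂ) (i j : Fin 3) :
    (kagomeSymbol Γ s (-χ) * kagomeSymbol Γ s (-χ)) i j =
      (starRingEnd ℂ) ((kagomeSymbol Γ s χ * kagomeSymbol Γ s χ) i j) := by
  simp only [Matrix.mul_apply, kagomeSymbol_neg, neg_mul_neg, map_sum, map_mul]

theorem sum_im_eq_zero_of_neg_eq_conj {G : Type*} [AddCommGroup G] [Fintype G] {f : G → ℂ}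
    (hf : ∀ χ, f (-χ) = (starRingEnd ℂ) (f χ)) : (∑ χ, f χ).im = 0 := by
  rw [← Complex.conj_eq_iff_im, map_sum]
  simp only [← hf]
  exact Equiv.sum_comp (Equiv.neg G) f

/-- Only the imaginary part matters. The `h²` part of the projection sums to a real number by
pairing `χ` with `-χ`; the `h` part has imaginary part `-κ ∑ (1 + Re χ(a)) / (2 E(χ))`, whose sum is
positive. -/
theorem lowMatrix_ne_zero (s : ℤˣ) {α β : Fin 3} {D a : Cell Γ} {κ : ℝ} (hκ : κ ≠ 0)
    (h : ∀ χ : AddChar (Cell Γ) ℂ, χ D * kagomeSymbol Γ s χ α β = I * κ * (1 + χ a))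
    {X Y : Cell Γ} (hXY : X - Y = D) : lowMatrix Γ s (X, α) (Y, β) ≠ 0 := by
  intro h0
  have hN : (Fintype.card (Cell Γ) : ℂ)⁻¹ ≠ 0 :=
    inv_ne_zero (Nat.cast_ne_zero.2 Fintype.card_ne_zero)
  simp only [lowMatrix, fourierMatrix, hXY] at h0
  replace h0 := (mul_eq_zero.1 h0).resolve_left hN
  let f : AddChar (Cell Γ) ℂ → ℂ := fun χ => χ D *
    ((2 * (kagomeEnergy Γ χ : ℂ) ^ 2)⁻¹ * (kagomeSymbol Γ s χ * kagomeSymbol Γ s χ) α β)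
  have hf : (∑ χ, f χ).im = 0 := by
    refine sum_im_eq_zero_of_neg_eq_conj fun χ => ?_
    simp only [f, kagomeSymbol_sq_neg, kagomeEnergy_neg, AddChar.neg_apply,
      AddChar.map_neg_eq_conj, map_mul, map_inv₀, map_pow, Complex.conj_ofReal, map_ofNat]
  have hsplit : ∀ χ : AddChar (Cell Γ) ℂ, χ D * lowSymbol Γ s χ α β =
      f χ - ((2 * kagomeEnergy Γ χ)⁻¹ * κ : ℝ) * (I * (1 + χ a)) := by
    intro χ
    have hE : (kagomeEnergy Γ χ : ℂ) ≠ 0 := by exact_mod_cast kagomeEnergy_ne_zero Γ χ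
    have e : χ D * lowSymbol Γ s χ α β =
        f χ - (2 * (kagomeEnergy Γ χ : ℂ))⁻¹ * (χ D * kagomeSymbol Γ s χ α β) := by
      simp only [f, lowSymbol, bandProj, Matrix.smul_apply, Matrix.add_apply, smul_eq_mul,
        Complex.ofReal_neg]
      field_simp
      ring
    rw [e, h]
    push_cast
    ring
  simp only [hsplit, Finset.sum_sub_distrib] at h0
  have him := congrArg Complex.im h0
  rw [Complex.sub_im, hf, Complex.im_sum, Complex.zero_im, zero_sub, neg_eq_zero] at him
  have hterm : ∀ χ : AddChar (Cell Γ) ℂ,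
      (((2 * kagomeEnergy Γ χ)⁻¹ * κ : ℝ) * (I * (1 + χ a)) : ℂ).im =
        κ * ((2 * kagomeEnergy Γ χ)⁻¹ * (1 + (χ a).re)) := by
    intro χ
    rw [Complex.im_ofReal_mul]
    simp
    ring
  simp only [hterm, ← Finset.mul_sum] at him
  have hsum := (mul_eq_zero.1 him).resolve_left hκ
  have hnn : ∀ χ ∈ (Finset.univ : Finset (AddChar (Cell Γ) ℂ)),
      0 ≤ (2 * kagomeEnergy Γ χ)⁻¹ * (1 + (χ a).re) := by
    intro χ _
    have h1 := Complex.abs_re_le_norm (χ a)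
    rw [AddChar.norm_apply] at h1
    have h2 := neg_le_of_abs_le h1
    have := kagomeEnergy_pos Γ χ
    exact mul_nonneg (by positivity) (by linarith)
  -- The trivial character exists on every torus and contributes strictly, which is why no size
  -- condition is needed.
  have h1 := (Finset.sum_eq_zero_iff_of_nonneg hnn).1 hsum 0 (Finset.mem_univ _)
  have := kagomeEnergy_pos Γ (0 : AddChar (Cell Γ) ℂ)
  rw [AddChar.zero_apply, Complex.one_re] at h1
  have : 0 < (2 * kagomeEnergy Γ (0 : AddChar (Cell Γ) ℂ))⁻¹ * (1 + 1) := by positivity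
  linarith

theorem intUnit_half_ne_zero (s : ℤˣ) : (((s : ℤ) : ℝ) / 2) ≠ 0 := by
  rcases Int.units_eq_one_or s with rfl | rfl <;> norm_num

theorem lowMatrix_bond_one (s : ℤˣ) (R : Cell Γ) : lowMatrix Γ s (R, 1) (R, 0) ≠ 0 := by
  refine lowMatrix_ne_zero Γ s (D := 0) (a := ((1, 0) : ℤ × ℤ)) (intUnit_half_ne_zero s) ?_
    (sub_self R)
  intro χ
  simp [kagomeSymbol]
  left
  ring

theorem lowMatrix_bond_two (s : ℤˣ) (R : Cell Γ) : lowMatrix Γ s (R, 2) (R, 0) ≠ 0 := by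
  refine lowMatrix_ne_zero Γ s (D := 0) (a := ((0, 1) : ℤ × ℤ))
    (neg_ne_zero.2 (intUnit_half_ne_zero s)) ?_ (sub_self R)
  intro χ
  simp [kagomeSymbol]
  ring

theorem lowMatrix_bond_one' (s : ℤˣ) (R : Cell Γ) :
    lowMatrix Γ s (R - ((1, 0) : ℤ × ℤ), 1) (R, 0) ≠ 0 := by
  refine lowMatrix_ne_zero Γ s (D := -((1, 0) : ℤ × ℤ)) (a := -((1, 0) : ℤ × ℤ))
    (intUnit_half_ne_zero s) ?_ (by abel)
  intro χ
  have h : χ (-((1, 0) : ℤ × ℤ)) * χ ((1, 0) : ℤ × ℤ) = 1 := by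
    rw [← AddChar.map_add_eq_mul, neg_add_cancel, AddChar.map_zero_eq_one]
  simp [kagomeSymbol]
  linear_combination (((s : ℤ) : ℂ) * I / 2) * h

theorem lowMatrix_bond_two' (s : ℤˣ) (R : Cell Γ) :
    lowMatrix Γ s (R - ((0, 1) : ℤ × ℤ), 2) (R, 0) ≠ 0 := by
  refine lowMatrix_ne_zero Γ s (D := -((0, 1) : ℤ × ℤ)) (a := -((0, 1) : ℤ × ℤ))
    (neg_ne_zero.2 (intUnit_half_ne_zero s)) ?_ (by abel)
  intro χ
  have h : χ (-((0, 1) : ℤ × ℤ)) * χ ((0, 1) : ℤ × ℤ) = 1 := by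
    rw [← AddChar.map_add_eq_mul, neg_add_cancel, AddChar.map_zero_eq_one]
  simp [kagomeSymbol]
  linear_combination -(((s : ℤ) : ℂ) * I / 2) * h

/-- Two bonds of the up triangle tie a cell together and two of the down triangle tie it to its
neighbours; the bonds between sublattices `1` and `2` are not needed. -/
theorem lowMatrix_irreducible (s : ℤˣ) (S : Set (Site Γ))
    (hS : ∀ x ∈ S, ∀ y ∉ S, lowMatrix Γ s x y = 0) : S = ∅ ∨ S = Set.univ := by
  have hiff : ∀ {x y}, lowMatrix Γ s x y ≠ 0 → (x ∈ S ↔ y ∈ S) := by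
    intro x y hxy
    constructor
    · intro hx
      by_contra hy
      exact hxy (hS x hx y hy)
    · intro hy
      by_contra hx
      refine hxy ?_
      rw [← (lowMatrix_isHermitian Γ s).apply, hS y hy x hx, star_zero]
  have hcell : ∀ R α, (R, α) ∈ S ↔ (R, (0 : Fin 3)) ∈ S := by
    intro R α
    fin_cases α
    · rfl
    · exact hiff (lowMatrix_bond_one Γ s R)
    · exact hiff (lowMatrix_bond_two Γ s R)
  rcases S.eq_empty_or_nonempty with h | ⟨⟨R₀, α⟩, h⟩
  · exact Or.inl h
  · right
    refine Set.eq_univ_of_forall fun ⟨R, β⟩ => ?_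
    rw [hcell] at h ⊢
    refine eq_univ_of_add_mem Γ (T := {R | (R, (0 : Fin 3)) ∈ S}) h ?_ ?_ R
    · intro R
      have := hiff (lowMatrix_bond_one' Γ s (R + ((1, 0) : ℤ × ℤ)))
      rw [add_sub_cancel_right, hcell] at this
      exact this
    · intro R
      have := hiff (lowMatrix_bond_two' Γ s (R + ((0, 1) : ℤ × ℤ)))
      rw [add_sub_cancel_right, hcell] at this
      exact this

/-- The ferromagnetism of the flattened model on an arbitrary torus. -/
theorem flattenedHopping_isUniqueFerromagnet (s : ℤˣ) {ε U : ℝ} (hε : ε < 0) (hU : 0 < U) :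
    IsUniqueFerromagnet (hubbard (flattenedHopping Γ s ε) U) (Fintype.card (Cell Γ)) := by
  classical
  -- Here `ε < 0` enters: the middle band at `0` stays strictly above the flat one, so `E - ε` has a
  -- square root and an inverse on the upper bands.
  have hpos : ∀ E : ℝ, 0 ≤ E → 0 < E - ε := fun E hE => by linarith
  rw [flattenedHopping_eq_upperMatrix]
  refine isUniqueFerromagnet_of_irreducible
    (B := upperMatrix Γ s fun E => Real.sqrt (E - ε)) (C := upperMatrix Γ s fun E => (E - ε)⁻¹)
    (P := lowMatrix Γ s) ?_ (lowMatrix_isHermitian Γ s) (upperMatrix_mul_lowMatrix Γ s _) ?_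
    (lowMatrix_trace Γ s) (lowMatrix_irreducible Γ s) ε hU
  · rw [upperMatrix_conjTranspose, upperMatrix_mul]
    refine upperMatrix_congr Γ s fun E hE => ?_
    exact (Real.mul_self_sqrt (hpos E hE).le).symm
  · rw [upperMatrix_mul, one_sub_lowMatrix]
    refine upperMatrix_congr Γ s fun E hE => ?_
    exact (inv_mul_cancel₀ (hpos E hE).ne').symm

end KagomeFerromagnet

/-- The projection onto the lowest band is irreducible on every torus, so that the size and the
modulus of the torus do not matter. -/
theorem mainTheorem2 (s : ℤˣ) (τ : ℂ) (hτ : 0 < τ.im) :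
    ∃ N₀ : ℕ, ∀ (Γ : AddSubgroup (ℤ × ℤ)) [Γ.FiniteIndex], HasModulus Γ τ →
      N₀ ≤ Fintype.card (Cell Γ) →
      ∀ (ε U : ℝ), ε < 0 → 0 < U →
        IsUniqueFerromagnet (hubbard (flattenedHopping Γ s ε) U) (Fintype.card (Cell Γ)) :=
  ⟨0, fun Γ _ _ _ _ _ hε hU => flattenedHopping_isUniqueFerromagnet Γ s hε hU⟩
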